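/- Let $M$ be a connected, complete, finite-dimensional smooth Riemannian manifold with Riemannian distance $d$ and Levi-Civita connection $\nabla$. Let $\mathrm R\colon TM\to M$ be a retraction, i.e. a smooth map with $\mathrm R_p(0_p)=p$ and $\mathcal D\mathrm R_p(0_p)=\mathrm{id}_{T_pM}$ for all $p$. Let $F$ be a $C^2$ vector field on $M$ and $p^*\in M$ a point with $F(p^*)=0$ such that $\nabla F(p^*)\colon T_{p^*}M\to T_{p^*}M$ is nonsingular. Let $\hat e$ be a vector field on $M$ whose norm is bounded on a neighbourhood of $p^*$. The perturbed damped Riemannian Newton method starts at $p_0\in M$. At iteration $k=0,1,2,\dots$ it solves $$\nabla F(p_k)[\xi_k]=-F(p_k)+\mu_k\hat e(p_k),\qquad \xi_k\in T_{p_k}M,$$ and sets $p_{k+1}=\mathrm R_{p_k}(\alpha_k\xi_k)$, where $0<\alpha_k\le 1$, $\mu_k>0$ and $\mu_{k+1}<\mu_k$. The parameters are chosen by a rule fixed in advance: the rule gives, for every $k$ and every $p\in M$, a set $A_k(p)$ of admissible pairs, and $(\mu_k,\alpha_k)\in A_k(p_k)$ is required; the choice within this set is free. Assume that for each fixed $k$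 the admissible values of $\mu_k$ tend to $0$ (uniformly over $A_k(p)$) as $p\to p^*$. Suppose that the rule satisfies one of the following two schemes. 1. $\mu_k=o(\|F(p_k)\|)$ and $\alpha_k\to1$, in the sense that for every $\varepsilon>0$ there are $K\in\mathbb N$ and a neighbourhood $U$ of $p^*$ such that $\mu\le\varepsilon\|F(p)\|$ and $1-\alpha\le\varepsilon$ for all $k\ge K$, $p\in U$, $(\mu,\alpha)\in A_k(p)$. 2. $\mu_k=O(\|F(p_k)\|^2)$ and $1-\alpha_k=O(\|F(p_k)\|)$, in the sense that there are $C\in\mathbb R$, $K\in\mathbb N$ and a neighbourhood $U$ of $p^*$ such that $\mu\le C\|F(p)\|^2$ and $1-\alpha\le C\|F(p)\|$ for all $k\ge K$, $p\in U$, $(\mu,\alpha)\in A_k(p)$. Then there is $\delta>0$ such that for all $p_0\in M$ with $d(p_0,p^*)<\delta$ the sequence $\{p_k\}$ is well defined: at every iterate $p_n$ reached by the method, for whatever admissible choices, $\nabla F(p_n)$ is nonsingular, so that the Newton equation there has exactly one solution. Furthermore, every infinite sequence $\{p_k\}$ that the method generates from such a $p_0$ converges to $p^*$, 1. superlinearly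 under scheme 1, i.e. $d(p_{k+1},p^*)=o(d(p_k,p^*))$ as $k\to\infty$; 2. quadratically under scheme 2, i.e. $d(p_{k+1},p^*)=O(d(p_k,p^*)^2)$ as $k\to\infty$. -/

import Mathlib

open Set Filter Topology Manifold Bundle
open scoped ContDiff

noncomputable section

namespace RiemannianNewton

variable {E : Type*} [NormedAddCommGroup E] [NormedSpace ℝ E]
  {H : Type*} [TopologicalSpace H] (I : ModelWithCorners ℝ E H)

/-- The connection `nabla` on the tangent bundle is the Levi-Civita connection: it is symmetric
(torsion-free) and compatible with the Riemannian metric. Mathlib writes `nabla F p v` for the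
covariant derivative `∇_v F` at `p`, so that `nabla F p` is the operator `∇F(p)` on `T_p M`. -/
def IsLeviCivita [FiniteDimensional ℝ E]
    {M : Type*} [TopologicalSpace M] [ChartedSpace H M] [IsManifold I ∞ M]
    [RiemannianBundle (fun x : M => TangentSpace I x)]
    [IsContMDiffRiemannianBundle I ∞ E (fun x : M => TangentSpace I x)]
    (nabla : CovariantDerivative I E (fun x : M => TangentSpace I x)) : Prop :=
  haveI : CompleteSpace E := FiniteDimensional.complete ℝ E
  nabla.torsion = 0 ∧ nabla.IsMetricCompatible

/-- A vector field `F` on `M` is of class `C^n`, as a section of the tangent bundle. -/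
def IsCnVectorField {M : Type*} [TopologicalSpace M] [ChartedSpace H M] [IsManifold I ∞ M]
    (n : ℕ∞) (F : (x : M) → TangentSpace I x) : Prop :=
  ContMDiff I I.tangent n (fun x : M => (⟨x, F x⟩ : TangentBundle I M))

/-- A retraction on `M`: a smooth map `R : TM → M` whose restriction `R_p` to `T_p M` satisfies
`R_p(0_p) = p` and `D R_p(0_p) = id`. Each tangent space is, as a vector space with its topology,
the model space `E`; this is used to differentiate `R_p` at the origin. -/
structure IsRetraction {M : Type*} [TopologicalSpace M] [ChartedSpace H M] [IsManifold I ∞ M]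
    (R : TangentBundle I M → M) : Prop where
  smooth : ContMDiff I.tangent I ∞ R
  map_zero : ∀ p : M, R ⟨p, 0⟩ = p
  hasMFDerivAt_zero : ∀ p : M,
    HasMFDerivAt 𝓘(ℝ, E) I (fun v : E => R ⟨p, (v : TangentSpace I p)⟩) 0
      (ContinuousLinearMap.id ℝ E)

/-- The sequences `p`, `ξ`, `μ`, `α` perform the first `n` iterations of the perturbed damped
Riemannian Newton method for the vector field `F`, with perturbation field `e` and retraction `R`.
Only `p 0, …, p n` and `ξ k`, `μ k`, `α k` for `k < n` are meant; other values play no role. -/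
structure IsRun {M : Type*} [TopologicalSpace M] [ChartedSpace H M] [IsManifold I ∞ M]
    (nabla : CovariantDerivative I E (fun x : M => TangentSpace I x))
    (F e : (x : M) → TangentSpace I x) (R : TangentBundle I M → M)
    (p : ℕ → M) (ξ : (k : ℕ) → TangentSpace I (p k)) (μ α : ℕ → ℝ) (n : ℕ) : Prop where
  newton : ∀ k < n, nabla F (p k) (ξ k) = -F (p k) + μ k • e (p k)
  step : ∀ k < n, p (k + 1) = R ⟨p k, α k • ξ k⟩
  mu_pos : ∀ k < n, 0 < μ k
  mu_lt : ∀ k, k + 1 < n → μ (k + 1) < μ k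
  alpha_pos : ∀ k < n, 0 < α k
  alpha_le : ∀ k < n, α k ≤ 1

/-- A rule for choosing the parameters: `A k p` is the set of pairs `(μ_k, α_k)` that may be chosen
at iteration `k` when the current iterate is `p`. (The choice within this set is free, and may
depend on the whole history of the iteration.) -/
abbrev ParameterRule (M : Type*) := ℕ → M → Set (ℝ × ℝ)

/-- The first `n` parameter pairs used along `p` obey the rule `A`. -/
def Obeys {M : Type*} (A : ParameterRule M) (p : ℕ → M) (μ α : ℕ → ℝ) (n : ℕ) : Prop :=
  ∀ k < n, (μ k, α k) ∈ A k (p k)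

/-- At each fixed iteration `k`, the choice of `μ_k` (a positive number in every run) tends to `0` as
the iterate tends to `q`. -/
def MuVanishesAt {M : Type*} [TopologicalSpace M] (A : ParameterRule M) (q : M) : Prop :=
  ∀ k : ℕ, ∀ ε > 0, ∀ᶠ p in 𝓝 q, ∀ m a : ℝ, (m, a) ∈ A k p → m ≤ ε

section Schemes

variable {M : Type*} [TopologicalSpace M] [ChartedSpace H M]
  [RiemannianBundle (fun x : M => TangentSpace I x)]

/-- The choice `μ_k = o(‖F(p_k)‖)`, `α_k → 1`, as `k → ∞` and `p_k → q`, uniformly over all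
admissible pairs. -/
def IsSuperlinearScheme (F : (x : M) → TangentSpace I x) (A : ParameterRule M) (q : M) : Prop :=
  ∀ ε > 0, ∀ᶠ kp : ℕ × M in atTop ×ˢ 𝓝 q, ∀ m a : ℝ, (m, a) ∈ A kp.1 kp.2 →
    m ≤ ε * ‖F kp.2‖ ∧ 1 - a ≤ ε

/-- The choice `μ_k = O(‖F(p_k)‖²)`, `1 - α_k = O(‖F(p_k)‖)`, as `k → ∞` and `p_k → q`, uniformly
over all admissible pairs. -/
def IsQuadraticScheme (F : (x : M) → TangentSpace I x) (A : ParameterRule M) (q : M) : Prop :=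
  ∃ C : ℝ, ∀ᶠ kp : ℕ × M in atTop ×ˢ 𝓝 q, ∀ m a : ℝ, (m, a) ∈ A kp.1 kp.2 →
    m ≤ C * ‖F kp.2‖ ^ 2 ∧ 1 - a ≤ C * ‖F kp.2‖

end Schemes

/-- `p k → q`, and the ratio `d(p (k+1), q) / d(p k, q)` tends to zero. -/
def ConvergesSuperlinearly {M : Type*} [MetricSpace M] (p : ℕ → M) (q : M) : Prop :=
  Tendsto p atTop (𝓝 q) ∧
    (fun k => dist (p (k + 1)) q) =o[atTop] (fun k => dist (p k) q)

/-- `p k → q`, and `d(p (k+1), q) ≤ ν d(p k, q)²` for a constant `ν` and all large `k`. -/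
def ConvergesQuadratically {M : Type*} [MetricSpace M] (p : ℕ → M) (q : M) : Prop :=
  Tendsto p atTop (𝓝 q) ∧
    (fun k => dist (p (k + 1)) q) =O[atTop] (fun k => dist (p k) q ^ 2)

end RiemannianNewton

end

namespace RiemannianNewton

section Sequences

variable {M : Type*} [MetricSpace M]

/-- Iterates of a time-dependent step relation that eventually halves the distance to `q` stay close
to `q` and converge to it, if they start close enough. -/
theorem exists_forall_dist_lt_of_steps {S : ℕ → M → M → Prop} {q : M}
    (hS : ∀ k, ∀ η > 0, ∃ δ > 0, ∀ p p', dist p q < δ → S k p p' → dist p' q < η)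
    {K : ℕ} {r : ℝ} (hr : 0 < r)
    (hK : ∀ k ≥ K, ∀ p p', dist p q < r → S k p p' → dist p' q ≤ dist p q / 2) :
    ∃ δ > 0, ∀ p : ℕ → M, dist (p 0) q < δ →
      (∀ n, (∀ k < n, S k (p k) (p (k + 1))) → dist (p n) q < r) ∧
      ((∀ k, S k (p k) (p (k + 1))) → Tendsto p atTop (𝓝 q)) := by
  have finite_phase : ∀ n, ∃ δ > 0, ∀ p : ℕ → M, dist (p 0) q < δ →
      ∀ m ≤ n, (∀ k < m, S k (p k) (p (k + 1))) → dist (p m) q < r := by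
    have reach : ∀ n, ∀ η > 0, ∃ δ > 0, ∀ p : ℕ → M, dist (p 0) q < δ →
        (∀ k < n, S k (p k) (p (k + 1))) → dist (p n) q < η := by
      intro n
      induction n with
      | zero => exact fun η hη => ⟨η, hη, fun p hp _ => hp⟩
      | succ n ih =>
        intro η hη
        obtain ⟨δ₁, h₁, H₁⟩ := hS n η hη
        obtain ⟨δ, h, H⟩ := ih δ₁ h₁
        exact ⟨δ, h, fun p hp hs => H₁ _ _ (H p hp fun k hk => hs k (by omega))
          (hs n (by omega))⟩
    intro n
    induction n with
    | zero =>
      refine ⟨r, hr, fun p hp m hm _ => ?_⟩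
      obtain rfl : m = 0 := by omega
      exact hp
    | succ n ih =>
      obtain ⟨δ₁, h₁, H₁⟩ := ih
      obtain ⟨δ₂, h₂, H₂⟩ := reach (n + 1) r hr
      refine ⟨min δ₁ δ₂, lt_min h₁ h₂, fun p hp m hm hs => ?_⟩
      rcases Nat.lt_or_ge n m with h | h
      · obtain rfl : m = n + 1 := by omega
        exact H₂ p (hp.trans_le (min_le_right _ _)) hs
      · exact H₁ p (hp.trans_le (min_le_left _ _)) m h hs
  obtain ⟨δ, hδ, H⟩ := finite_phase K
  have key : ∀ p : ℕ → M, dist (p 0) q < δ → ∀ n, (∀ k < K + n, S k (p k) (p (k + 1))) →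
      dist (p (K + n)) q < r ∧ dist (p (K + n)) q ≤ r * (1 / 2) ^ n := by
    intro p hp n
    induction n with
    | zero =>
      intro hs
      have := H p hp K le_rfl hs
      exact ⟨this, by simpa using this.le⟩
    | succ n ih =>
      intro hs
      obtain ⟨h₁, h₂⟩ := ih fun k hk => hs k (by omega)
      have h₃ := hK (K + n) (by omega) _ _ h₁ (hs (K + n) (by omega))
      have h₄ : (0 : ℝ) ≤ dist (p (K + n)) q := dist_nonneg
      rw [← add_assoc]
      refine ⟨by linarith, ?_⟩
      rw [pow_succ]
      linarith
  refine ⟨δ, hδ, fun p hp => ⟨fun n hs => ?_, fun hs => ?_⟩⟩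
  · rcases le_total n K with h | h
    · exact H p hp n h hs
    · obtain ⟨m, rfl⟩ := Nat.exists_eq_add_of_le h
      exact (key p hp m hs).1
  · rw [← tendsto_add_atTop_iff_nat K, tendsto_iff_dist_tendsto_zero]
    refine squeeze_zero (fun _ => dist_nonneg) (g := fun n => r * (1 / 2) ^ n) (fun n => ?_) ?_
    · rw [add_comm n K]
      exact (key p hp n fun k _ => hs k).2
    · simpa using (tendsto_pow_atTop_nhds_zero_of_lt_one (r := (1 / 2 : ℝ)) (by norm_num)
        (by norm_num)).const_mul r

end Sequences


section ModelSpace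

variable {E : Type*} [NormedAddCommGroup E] [NormedSpace ℝ E]
  {G : Type*} [NormedAddCommGroup G] [NormedSpace ℝ G]

/-- The first derivative of a `C²` map is Lipschitz near a point. -/
theorem exists_ball_fderiv_lipschitz {f : E → G} {x₀ : E} (hf : ContDiffAt ℝ 2 f x₀) :
    ∃ L ≥ (0 : ℝ), ∃ r > 0, (∀ x ∈ Metric.ball x₀ r, DifferentiableAt ℝ f x) ∧
      ∀ x ∈ Metric.ball x₀ r, ∀ y ∈ Metric.ball x₀ r,
        ‖fderiv ℝ f x - fderiv ℝ f y‖ ≤ L * ‖x - y‖ := by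
  have h1 : ContDiffAt ℝ 1 (fderiv ℝ f) x₀ := hf.fderiv_right (by norm_num)
  obtain ⟨K, t, ht, hK⟩ := h1.exists_lipschitzOnWith
  have h2 : ∀ᶠ x in 𝓝 x₀, DifferentiableAt ℝ f x :=
    (hf.eventually (by simp)).mono fun x hx => hx.differentiableAt (by simp)
  obtain ⟨r, hr, hball⟩ := Metric.mem_nhds_iff.1 (inter_mem ht h2)
  refine ⟨K, K.2, r, hr, fun x hx => (hball hx).2, fun x hx y hy => ?_⟩
  simpa [dist_eq_norm] using hK.dist_le_mul x (hball hx).1 y (hball hy).1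

/-- First-order Taylor expansion based at the variable point `x`. -/
theorem norm_image_sub_fderiv_le {f : E → G} {x₀ : E} {L r : ℝ} (hL : 0 ≤ L)
    (hd : ∀ x ∈ Metric.ball x₀ r, DifferentiableAt ℝ f x)
    (hlip : ∀ x ∈ Metric.ball x₀ r, ∀ y ∈ Metric.ball x₀ r,
        ‖fderiv ℝ f x - fderiv ℝ f y‖ ≤ L * ‖x - y‖)
    {x y : E} (hx : x ∈ Metric.ball x₀ r) (hy : y ∈ Metric.ball x₀ r) :
    ‖f y - f x - fderiv ℝ f x (y - x)‖ ≤ L * ‖y - x‖ ^ 2 := by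
  have hseg : segment ℝ x y ⊆ Metric.ball x₀ r := (convex_ball x₀ r).segment_subset hx hy
  have := (convex_segment x y).norm_image_sub_le_of_norm_fderiv_le' (𝕜 := ℝ) (f := f)
    (φ := fderiv ℝ f x) (C := L * ‖y - x‖) (fun z hz => hd z (hseg hz))
    (fun z hz => (hlip z (hseg hz) x hx).trans ?_) (left_mem_segment ℝ x y)
    (right_mem_segment ℝ x y)
  · rw [sq, ← mul_assoc]; exact this
  · refine mul_le_mul_of_nonneg_left ?_ hL
    rw [segment_eq_image'] at hz
    obtain ⟨t, ht, rfl⟩ := hz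
    simp only [add_sub_cancel_left, norm_smul, Real.norm_eq_abs, abs_of_nonneg ht.1]
    exact mul_le_of_le_one_left (norm_nonneg _) ht.2

/-- A map with `ρ (x, 0) = x` and `∂₂ρ (x, 0) = id` agrees with addition to second order. -/
theorem exists_norm_retraction_sub_le {ρ : E × E → E} {x₀ : E} (hρ : ContDiffAt ℝ 2 ρ (x₀, 0))
    (h0 : ∀ᶠ x in 𝓝 x₀, ρ (x, 0) = x)
    (h1 : ∀ᶠ x in 𝓝 x₀, HasFDerivAt (fun v => ρ (x, v)) (ContinuousLinearMap.id ℝ E) 0) :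
    ∃ L ≥ (0 : ℝ), ∃ r > 0, ∀ x v, ‖x - x₀‖ < r → ‖v‖ < r → ‖ρ (x, v) - x - v‖ ≤ L * ‖v‖ ^ 2 := by
  obtain ⟨L, hL, r, hr, hd, hlip⟩ := exists_ball_fderiv_lipschitz hρ
  obtain ⟨s, hs, hball⟩ := Metric.mem_nhds_iff.1 (inter_mem h0 h1)
  refine ⟨L, hL, min r s, lt_min hr hs, fun x v hx hv => ?_⟩
  have hxs : x ∈ Metric.ball x₀ s := by
    rw [mem_ball_iff_norm]; exact hx.trans_le (min_le_right _ _)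
  have hxr : ‖x - x₀‖ < r := hx.trans_le (min_le_left _ _)
  have hvr : ‖v‖ < r := hv.trans_le (min_le_left _ _)
  have hm0 : (x, (0 : E)) ∈ Metric.ball (x₀, (0 : E)) r := by
    rw [mem_ball_iff_norm, Prod.mk_sub_mk, Prod.norm_mk]; simpa using hxr
  have hmv : (x, v) ∈ Metric.ball (x₀, (0 : E)) r := by
    rw [mem_ball_iff_norm, Prod.mk_sub_mk, Prod.norm_mk]; simpa using ⟨hxr, hvr⟩
  have key := norm_image_sub_fderiv_le hL hd hlip hm0 hmv
  have hid : (fderiv ℝ ρ (x, 0)) (0, v) = v := by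
    have hc : HasFDerivAt (fun v : E => ρ (x, v))
        ((fderiv ℝ ρ (x, 0)).comp (ContinuousLinearMap.inr ℝ E E)) 0 :=
      (hd _ hm0).hasFDerivAt.comp (0 : E) (hasFDerivAt_prodMk_right x (0 : E))
    have := hc.unique (hball hxs).2
    simpa using congr($this v)
  rw [(hball hxs).1, Prod.mk_sub_mk, sub_self, sub_zero, hid] at key
  simpa using key

/-- Linearised Newton steps near a nondegenerate zero `x₀` of a `C²` map `f`, with the derivative
of `f` at `x` replaced by an operator `N` at distance `O(‖f x‖)` and with a perturbed right-hand
side. -/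
theorem exists_newton_step_estimate [FiniteDimensional ℝ E] {f : E → E} {x₀ : E}
    (hf : ContDiffAt ℝ 2 f x₀) (hzero : f x₀ = 0)
    (hinj : Function.Injective (fderiv ℝ f x₀)) {C₀ : ℝ} (hC₀ : 0 ≤ C₀) :
    ∃ C > 0, ∃ r > 0, ∀ x, ‖x - x₀‖ < r → ‖f x‖ ≤ C * ‖x - x₀‖ ∧
      ∀ N : E →L[ℝ] E, ‖N - fderiv ℝ f x‖ ≤ C₀ * ‖f x‖ → Function.Bijective N ∧
        ∀ (ξ η : E) (μ : ℝ), 0 ≤ μ → ‖η‖ ≤ C₀ → N ξ = -f x + μ • η →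
          ‖x - x₀ + ξ‖ ≤ C * (‖x - x₀‖ ^ 2 + μ) ∧ ‖ξ‖ ≤ C * (‖x - x₀‖ + μ) := by
  obtain ⟨L, hL, r₁, hr₁, hd, hlip⟩ := exists_ball_fderiv_lipschitz hf
  obtain ⟨K, hK, hanti⟩ := ((fderiv ℝ f x₀) : E →ₗ[ℝ] E).exists_antilipschitzWith
    (LinearMap.ker_eq_bot.2 hinj)
  set A := fderiv ℝ f x₀
  have hA' : ∀ v, ‖v‖ ≤ K * ‖A v‖ := fun v => by
    simpa [dist_eq_norm] using hanti.le_mul_dist v 0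
  have hKpos : (0 : ℝ) < K := by exact_mod_cast hK
  have hx₀ : x₀ ∈ Metric.ball x₀ r₁ := Metric.mem_ball_self hr₁
  set D := ‖A‖ + L + 1 with hD
  have hDpos : 0 < D := by positivity
  set P := L + C₀ * D with hP
  have hP0 : 0 ≤ P := by positivity
  set C := D + 2 * K * (P + C₀) + 1 with hC
  have hCpos : 0 < C := by positivity
  set r := min (min r₁ 1) (1 / (2 * K * (P + 1)))
  have hrpos : 0 < r := by positivity
  refine ⟨C, hCpos, r, hrpos, fun x hx => ?_⟩
  have hxr₁ : ‖x - x₀‖ < r₁ := hx.trans_le ((min_le_left _ _).trans (min_le_left _ _))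
  have hx1 : ‖x - x₀‖ ≤ 1 := (hx.trans_le ((min_le_left _ _).trans (min_le_right _ _))).le
  have hxK : ‖x - x₀‖ ≤ 1 / (2 * K * (P + 1)) := (hx.trans_le (min_le_right _ _)).le
  have hxb : x ∈ Metric.ball x₀ r₁ := by rwa [mem_ball_iff_norm]
  have hn : 0 ≤ ‖x - x₀‖ := norm_nonneg _
  set d := ‖x - x₀‖
  have hfx : ‖f x‖ ≤ D * d := by
    have h1 := norm_image_sub_fderiv_le hL hd hlip hx₀ hxb
    rw [hzero, sub_zero] at h1
    have h2 : ‖f x‖ ≤ ‖f x - A (x - x₀)‖ + ‖A (x - x₀)‖ := by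
      simpa using norm_add_le (f x - A (x - x₀)) (A (x - x₀))
    have h3 := A.le_opNorm (x - x₀)
    have h4 : L * d ^ 2 ≤ L * d := mul_le_mul_of_nonneg_left (by nlinarith) hL
    calc ‖f x‖ ≤ L * d ^ 2 + ‖A‖ * d := by linarith
      _ ≤ D * d := by rw [hD]; linarith
  refine ⟨hfx.trans (mul_le_mul_of_nonneg_right ?_ hn), fun N hN => ?_⟩
  · have : 0 ≤ 2 * K * (P + C₀) := by positivity
    linarith
  have hNfx : ‖N - fderiv ℝ f x‖ ≤ C₀ * D * d := by
    rw [mul_assoc]; exact hN.trans (mul_le_mul_of_nonneg_left hfx hC₀)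
  have hNA : ‖N - A‖ ≤ P * d := by
    have h1 := hlip x hxb x₀ hx₀
    have h2 := norm_add_le (N - fderiv ℝ f x) (fderiv ℝ f x - A)
    rw [sub_add_sub_cancel] at h2
    rw [hP, add_mul]
    linarith
  have hNanti : ∀ v, ‖v‖ ≤ 2 * K * ‖N v‖ := by
    intro v
    have h1 := hA' v
    have h2 : ‖A v‖ ≤ ‖N v‖ + ‖(N - A) v‖ := by
      have := norm_sub_le (N v) ((N - A) v)
      simpa using this
    have h3 : ‖(N - A) v‖ ≤ P * d * ‖v‖ :=
      ((N - A).le_opNorm v).trans (mul_le_mul_of_nonneg_right hNA (norm_nonneg _))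
    have h4 : 2 * K * (P * d) ≤ 1 := by
      rw [le_div_iff₀ (by positivity)] at hxK
      nlinarith
    have h5 : 2 * K * (P * d * ‖v‖) ≤ ‖v‖ := by
      have := mul_le_mul_of_nonneg_right h4 (norm_nonneg v)
      linarith
    have h6 : K * ‖A v‖ ≤ K * (‖N v‖ + P * d * ‖v‖) :=
      mul_le_mul_of_nonneg_left (by linarith) hKpos.le
    linarith
  have hNinj : Function.Injective N := by
    rw [injective_iff_map_eq_zero]
    intro v hv
    have := hNanti v
    rw [hv, norm_zero, mul_zero] at this
    exact norm_le_zero_iff.1 this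
  refine ⟨⟨hNinj, (LinearMap.injective_iff_surjective (f := (N : E →ₗ[ℝ] E))).1 hNinj⟩, ?_⟩
  intro ξ η μ hμ hη hξ
  have hmain : ‖x - x₀ + ξ‖ ≤ 2 * K * (P * d ^ 2 + C₀ * μ) := by
    refine (hNanti _).trans (mul_le_mul_of_nonneg_left ?_ (by positivity))
    have e1 : N (x - x₀ + ξ) = (N - fderiv ℝ f x) (x - x₀)
        + (f x₀ - f x - fderiv ℝ f x (x₀ - x)) + μ • η := by
      rw [map_add, hξ, hzero, ← neg_sub x x₀, map_neg]
      simp only [sub_apply]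
      abel
    have h1 := norm_image_sub_fderiv_le hL hd hlip hxb hx₀
    rw [norm_sub_rev x₀ x] at h1
    have h2 : ‖(N - fderiv ℝ f x) (x - x₀)‖ ≤ C₀ * D * d * d :=
      ((N - fderiv ℝ f x).le_opNorm _).trans (mul_le_mul_of_nonneg_right hNfx hn)
    have h3 : ‖μ • η‖ ≤ C₀ * μ := by
      rw [norm_smul, Real.norm_eq_abs, abs_of_nonneg hμ, mul_comm]
      exact mul_le_mul_of_nonneg_right hη hμ
    rw [e1]
    refine (norm_add₃_le).trans ?_
    rw [hP]
    nlinarith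
  have h2KP : 0 ≤ 2 * (K : ℝ) * P := by positivity
  have h2KC : 0 ≤ 2 * (K : ℝ) * C₀ := by positivity
  have hfirst : ‖x - x₀ + ξ‖ ≤ (2 * K * (P + C₀)) * (d ^ 2 + μ) := by
    refine hmain.trans ?_
    nlinarith [mul_nonneg h2KP hμ, mul_nonneg h2KC (sq_nonneg d)]
  have hsq : d ^ 2 ≤ d := by nlinarith
  have hB : 0 ≤ 2 * (K : ℝ) * (P + C₀) := by positivity
  refine ⟨hfirst.trans (mul_le_mul_of_nonneg_right (by linarith) (by positivity)), ?_⟩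
  have h1 : ‖ξ‖ ≤ ‖x - x₀ + ξ‖ + d := by
    simpa using norm_sub_le (x - x₀ + ξ) (x - x₀)
  have h2 := mul_le_mul_of_nonneg_left (add_le_add_left hsq μ) hB
  have h3 : 0 ≤ (D + 1) * μ := by positivity
  have h4 : 0 ≤ D * d := by positivity
  calc ‖ξ‖ ≤ 2 * K * (P + C₀) * (d + μ) + d := by linarith
    _ ≤ C * (d + μ) := by rw [hC]; linarith

end ModelSpace


section Distance

open scoped NNReal ENNReal

open MeasureTheory in
theorem eventually_edist_extChartAt_le_riemannianEDist
    {E : Type*} [NormedAddCommGroup E] [NormedSpace ℝ E] [CompleteSpace E]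
    {H : Type*} [TopologicalSpace H] (I : ModelWithCorners ℝ E H)
    {M : Type*} [TopologicalSpace M] [RegularSpace M] [ChartedSpace H M] [IsManifold I 1 M]
    [RiemannianBundle (fun x : M => TangentSpace I x)]
    [IsContinuousRiemannianBundle E (fun x : M => TangentSpace I x)] (x : M) :
    ∃ C > (0 : ℝ≥0), ∀ᶠ y in 𝓝 x,
      edist (extChartAt I x x) (extChartAt I x y) ≤ C * riemannianEDist I x y := by
  obtain ⟨C, C_pos, hC⟩ := eventually_enorm_mfderiv_extChartAt_lt I x
  obtain ⟨U, hU, hUC⟩ := hC.exists_mem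
  obtain ⟨c, hc, hcsub⟩ := setOfPred_riemannianEDist_lt_subset_nhds' I
    (inter_mem hU (chart_source_mem_nhds H x))
  refine ⟨C, C_pos, ?_⟩
  filter_upwards [eventually_riemannianEDist_lt I x hc] with y hy
  have hC0 : (C : ℝ≥0∞) ≠ 0 := by simpa using C_pos.ne'
  rw [mul_comm, ← ENNReal.div_le_iff hC0 ENNReal.coe_ne_top]
  refine le_of_forall_gt_imp_ge_of_dense fun ρ hρ => ?_
  rw [ENNReal.div_le_iff hC0 ENNReal.coe_ne_top, mul_comm]
  obtain ⟨γ, hγx, hγy, hγs, hγ, -⟩ :=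
    exists_lt_locally_constant_of_riemannianEDist_lt (lt_min hρ hy) zero_lt_one
  have hmem : ∀ t ∈ Icc (0 : ℝ) 1, γ t ∈ U ∩ (chartAt H x).source := by
    intro t ht
    apply hcsub
    calc riemannianEDist I x (γ t) ≤ pathELength I γ 0 t :=
          riemannianEDist_le_pathELength hγs.contMDiffOn hγx rfl ht.1
      _ ≤ pathELength I γ 0 1 := pathELength_mono le_rfl ht.2
      _ < c := hγ.trans_le (min_le_right _ _)
  have hγ' : CMDiff[Icc 0 1] 1 (extChartAt I x ∘ γ) :=
    contMDiffOn_extChartAt.comp (I' := I) (t := (chartAt H x).source)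
      hγs.contMDiffOn (fun t ht => (hmem t ht).2)
  calc edist (extChartAt I x x) (extChartAt I x y)
      = ‖(extChartAt I x ∘ γ) 1 - (extChartAt I x ∘ γ) 0‖ₑ := by
        rw [edist_comm, edist_eq_enorm_sub]; simp [hγx, hγy]
    _ ≤ ∫⁻ t in Icc 0 1, ‖derivWithin (extChartAt I x ∘ γ) (Icc 0 1) t‖ₑ := by
      apply enorm_sub_le_lintegral_derivWithin_Icc_of_contDiffOn_Icc _ zero_le_one
      rwa [← contMDiffOn_iff_contDiffOn]
    _ ≤ ∫⁻ t in Icc 0 1, C * ‖mfderiv[Icc 0 1] γ t 1‖ₑ := by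
      apply setLIntegral_mono' measurableSet_Icc (fun t ht => ?_)
      have h1 : mfderiv[Icc 0 1] (extChartAt I x ∘ γ) t =
          (mfderiv% (extChartAt I x) (γ t)) ∘L (mfderiv[Icc 0 1] γ t) := by
        apply mfderiv_comp_mfderivWithin
        · exact mdifferentiableAt_extChartAt (hmem t ht).2
        · exact (hγs.mdifferentiable one_ne_zero).mdifferentiableOn _ ht
        · rw [uniqueMDiffWithinAt_iff_uniqueDiffWithinAt]
          exact uniqueDiffOn_Icc zero_lt_one _ ht
      have h2 : derivWithin (extChartAt I x ∘ γ) (Icc 0 1) t =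
          (mfderiv% (extChartAt I x) (γ t)) (mfderiv[Icc 0 1] γ t 1) := by
        rw [← fderivWithin_derivWithin, ← mfderivWithin_eq_fderivWithin]
        exact congr($h1 1)
      rw [h2]
      exact (ContinuousLinearMap.le_opENorm _ _).trans
        (mul_le_mul_left (hUC _ (hmem t ht).1).le _)
    _ = C * pathELength I γ 0 1 := by
      rw [lintegral_const_mul' _ _ ENNReal.coe_ne_top,
          pathELength_eq_lintegral_mfderivWithin_Icc]
    _ ≤ C * ρ := by
      gcongr
      exact hγ.le.trans (min_le_left _ _)

/-- Near `x`, the distance to `x` and the distance in the chart at `x` are comparable. -/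
theorem exists_dist_extChartAt_comparable
    {E : Type*} [NormedAddCommGroup E] [NormedSpace ℝ E] [CompleteSpace E]
    {H : Type*} [TopologicalSpace H] (I : ModelWithCorners ℝ E H)
    {M : Type*} [MetricSpace M] [ChartedSpace H M] [IsManifold I 1 M]
    [RiemannianBundle (fun x : M => TangentSpace I x)]
    [IsContinuousRiemannianBundle E (fun x : M => TangentSpace I x)]
    [IsRiemannianManifold I M] (x : M) :
    ∃ C > (0 : ℝ), ∀ᶠ y in 𝓝 x, ‖extChartAt I x y - extChartAt I x x‖ ≤ C * dist y x ∧
      dist y x ≤ C * ‖extChartAt I x y - extChartAt I x x‖ := by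
  obtain ⟨C₁, hC₁, h₁⟩ := eventually_edist_extChartAt_le_riemannianEDist I x
  obtain ⟨C₂, hC₂, h₂⟩ := eventually_riemannianEDist_le_edist_extChartAt I x
  have hcompare : ∀ {a b : ℝ≥0∞} {c d : ℝ} {C : ℝ≥0}, a = ENNReal.ofReal c → b = ENNReal.ofReal d →
      0 ≤ c → 0 ≤ d → a ≤ C * b → c ≤ C * d := by
    rintro _ _ c d C rfl rfl hc hd h
    rw [← ENNReal.ofReal_coe_nnreal, ← ENNReal.ofReal_mul (NNReal.coe_nonneg C)] at h
    exact (ENNReal.ofReal_le_ofReal_iff (mul_nonneg C.2 hd)).1 h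
  refine ⟨max C₁ C₂, lt_max_of_lt_left (by exact_mod_cast hC₁), ?_⟩
  filter_upwards [h₁, h₂] with y hy₁ hy₂
  rw [← IsRiemannianManifold.out (I := I)] at hy₁ hy₂
  rw [← dist_eq_norm, dist_comm y x, dist_comm (extChartAt I x y)]
  constructor
  · exact (hcompare (edist_dist _ _) (edist_dist _ _) dist_nonneg dist_nonneg hy₁).trans
      (mul_le_mul_of_nonneg_right (le_max_left _ _) dist_nonneg)
  · exact (hcompare (edist_dist _ _) (edist_dist _ _) dist_nonneg dist_nonneg hy₂).trans
      (mul_le_mul_of_nonneg_right (le_max_right _ _) dist_nonneg)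

end Distance


section Coordinates

variable {E : Type*} [NormedAddCommGroup E] [NormedSpace ℝ E]
  {H : Type*} [TopologicalSpace H] (I : ModelWithCorners ℝ E H)
  {M : Type*} [TopologicalSpace M] [ChartedSpace H M] [IsManifold I ∞ M]

/-- The components of tangent vectors at `p` in the chart at `q`. -/
noncomputable def chartDeriv (q p : M) : TangentSpace I p →L[ℝ] E :=
  (trivializationAt E (TangentSpace I : M → Type _) q).continuousLinearMapAt ℝ p

/-- The vector field with constant components `u` in the chart at `q`. -/
noncomputable def coordField (q : M) (u : E) (p : M) : TangentSpace I p :=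
  (trivializationAt E (TangentSpace I : M → Type _) q).symmL ℝ p u

/-- The constant vector field `u` on the model space. -/
def constField (u : E) (x : E) : TangentSpace 𝓘(ℝ, E) x := u

variable {I} {q p : M}

theorem chartDeriv_coordField (hp : p ∈ (chartAt H q).source) (u : E) :
    chartDeriv I q p (coordField I q u p) = u :=
  (trivializationAt E (TangentSpace I : M → Type _) q).continuousLinearMapAt_symmL
    (R := ℝ) (b := p) hp u

theorem coordField_chartDeriv (hp : p ∈ (chartAt H q).source) (v : TangentSpace I p) :
    coordField I q (chartDeriv I q p v) p = v :=
  (trivializationAt E (TangentSpace I : M → Type _) q).symmL_continuousLinearMapAt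
    (R := ℝ) (b := p) hp v

theorem coordField_smul (c : ℝ) (u : E) :
    coordField I q (c • u) p = c • coordField I q u p := map_smul _ c u

theorem coordField_sum {ι : Type*} (s : Finset ι) (u : ι → E) :
    coordField I q (∑ i ∈ s, u i) p = ∑ i ∈ s, coordField I q (u i) p := map_sum _ u s

theorem chartDeriv_eq_mvfderiv (hp : p ∈ (chartAt H q).source) :
    chartDeriv I q p = mvfderiv I (extChartAt I q) p :=
  TangentBundle.continuousLinearMapAt_trivializationAt hp

theorem chartDeriv_eq_trivializationAt (hp : p ∈ (chartAt H q).source) (v : TangentSpace I p) :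
    chartDeriv I q p v = (trivializationAt E (TangentSpace I : M → Type _) q ⟨p, v⟩).2 := by
  rw [chartDeriv, Trivialization.continuousLinearMapAt_apply,
    Trivialization.linearMapAt_apply, if_pos]
  exact hp

theorem coordField_eq_mpullback (hp : p ∈ (chartAt H q).source) (u : E) :
    coordField I q u p =
      VectorField.mpullback I 𝓘(ℝ, E) (extChartAt I q) (constField u) p := by
  have hinv : (mfderiv I 𝓘(ℝ, E) (extChartAt I q) p).IsInvertible :=
    isInvertible_mfderiv_extChartAt (by rwa [extChartAt_source])
  have h := chartDeriv_coordField (I := I) hp u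
  rw [chartDeriv_eq_mvfderiv hp] at h
  have h' : mfderiv I 𝓘(ℝ, E) (extChartAt I q) p (coordField I q u p) = u := h
  exact (hinv.inverse_apply_eq.2 h'.symm).symm

theorem contMDiffAt_coordField (hp : p ∈ (chartAt H q).source) (u : E) :
    ContMDiffAt I I.tangent ∞ (fun x => (⟨x, coordField I q u x⟩ : TangentBundle I M)) p := by
  refine ((trivializationAt E (TangentSpace I : M → Type _) q).contMDiffAt_iff
    (f := fun x => (⟨x, coordField I q u x⟩ : TangentBundle I M)) ?_).2
    ⟨contMDiffAt_id, (contMDiffAt_const (c := u)).congr_of_eventuallyEq ?_⟩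
  · exact (Trivialization.mem_source _).2 hp
  · filter_upwards [(chartAt H q).open_source.mem_nhds hp] with x hx
    rw [← chartDeriv_eq_trivializationAt hx, chartDeriv_coordField hx]

theorem contMDiffAt_chartDeriv {n : ℕ∞} (hp : p ∈ (chartAt H q).source)
    {F : (x : M) → TangentSpace I x}
    (hF : ContMDiffAt I I.tangent n (fun x => (⟨x, F x⟩ : TangentBundle I M)) p) :
    ContMDiffAt I 𝓘(ℝ, E) n (fun x => chartDeriv I q x (F x)) p := by
  have : ContMDiffVectorBundle n E (TangentSpace I : M → Type _) I :=
    ContMDiffVectorBundle.of_le (n := ∞) (mod_cast le_top)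
  have h := (((trivializationAt E (TangentSpace I : M → Type _) q).contMDiffAt_iff
    (f := fun x => (⟨x, F x⟩ : TangentBundle I M)) ((Trivialization.mem_source _).2 hp)).1 hF).2
  refine h.congr_of_eventuallyEq ?_
  filter_upwards [(chartAt H q).open_source.mem_nhds hp] with x hx
  exact chartDeriv_eq_trivializationAt hx _

theorem mlieBracket_coordField [CompleteSpace E] (hp : p ∈ (chartAt H q).source) (u v : E) :
    VectorField.mlieBracket I (coordField I q u) (coordField I q v) p = 0 := by
  have hu : ∀ u : E, coordField I q u =ᶠ[𝓝 p]
      VectorField.mpullback I 𝓘(ℝ, E) (extChartAt I q) (constField u) := fun u => by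
    filter_upwards [(chartAt H q).open_source.mem_nhds hp] with x hx
    rw [coordField_eq_mpullback hx]
  have hconst : ∀ (u : E) (y : E), MDifferentiableAt 𝓘(ℝ, E) 𝓘(ℝ, E).tangent
      (fun x => (⟨x, constField u x⟩ : TangentBundle 𝓘(ℝ, E) E)) y := fun u y =>
    (contMDiffAt_vectorSpace_iff_contDiffAt (V := constField u) (n := 1)).2
      (contDiffAt_const (c := u))
      |>.mdifferentiableAt one_ne_zero
  have : IsManifold I (minSmoothness ℝ 3) M := by
    rw [minSmoothness_of_isRCLikeNormedField]
    exact IsManifold.of_le (n := ∞) (by norm_cast)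
  rw [(hu u).mlieBracket_vectorField_eq (hu v),
    ← VectorField.mpullback_mlieBracket (n := ∞) (hconst u _) (hconst v _)
      (contMDiffAt_extChartAt' hp) (by simp; norm_cast)]
  have h0 :
      VectorField.mlieBracket 𝓘(ℝ, E) (constField u) (constField v) (extChartAt I q p) = 0 := by
    rw [← VectorField.mlieBracketWithin_univ, VectorField.mlieBracketWithin_eq_lieBracketWithin]
    have hd : ∀ u : E, fderivWithin ℝ (constField u) univ (extChartAt I q p) = 0 := fun u =>
      fderivWithin_const_apply u
    change fderivWithin ℝ (constField v) univ (extChartAt I q p) u -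
      fderivWithin ℝ (constField u) univ (extChartAt I q p) v = 0
    rw [hd, hd]
    exact sub_self _
  exact (congrArg _ h0).trans (map_zero _)

theorem differentiableAt_comp_extChartAt_symm [I.Boundaryless] {G : Type*} [NormedAddCommGroup G]
    [NormedSpace ℝ G] {g : M → G} (hp : p ∈ (chartAt H q).source)
    (hg : MDifferentiableAt I 𝓘(ℝ, G) g p) :
    DifferentiableAt ℝ (g ∘ (extChartAt I q).symm) (extChartAt I q p) := by
  have hp' : p ∈ (extChartAt I q).source := by rwa [extChartAt_source]
  have hsymm : MDifferentiableAt 𝓘(ℝ, E) I (extChartAt I q).symm (extChartAt I q p) := by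
    have := mdifferentiableWithinAt_extChartAt_symm (I := I) ((extChartAt I q).map_source hp')
    rwa [I.range_eq_univ, mdifferentiableWithinAt_univ] at this
  rw [← mdifferentiableAt_iff_differentiableAt]
  refine MDifferentiableAt.comp _ ?_ hsymm
  rwa [(extChartAt I q).left_inv hp']

theorem mvfderiv_coordField [I.Boundaryless] {G : Type*} [NormedAddCommGroup G] [NormedSpace ℝ G]
    {g : M → G} (hp : p ∈ (chartAt H q).source) (hg : MDifferentiableAt I 𝓘(ℝ, G) g p)
    (v : TangentSpace I p) :
    mvfderiv I g p v = fderiv ℝ (g ∘ (extChartAt I q).symm) (extChartAt I q p)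
      (chartDeriv I q p v) := by
  have hp' : p ∈ (extChartAt I q).source := by rwa [extChartAt_source]
  have hG := (differentiableAt_comp_extChartAt_symm hp hg).mdifferentiableAt
  have heq : g =ᶠ[𝓝 p] (g ∘ (extChartAt I q).symm) ∘ extChartAt I q := by
    filter_upwards [extChartAt_source_mem_nhds' hp'] with x hx
    exact congrArg g ((extChartAt I q).left_inv hx).symm
  rw [chartDeriv_eq_mvfderiv hp]
  have h1 : mvfderiv I g p = mvfderiv I ((g ∘ (extChartAt I q).symm) ∘ extChartAt I q) p := by
    unfold mvfderiv
    rw [heq.mfderiv_eq]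
    rw [heq.self_of_nhds]
  have h2 := mfderiv_comp_apply p hG (mdifferentiableAt_extChartAt hp) v
  have h3 : mvfderiv 𝓘(ℝ, E) (g ∘ (extChartAt I q).symm) (extChartAt I q p) =
      fderiv ℝ (g ∘ (extChartAt I q).symm) (extChartAt I q p) := by
    rw [mvfderiv, mfderiv_eq_fderiv]
    rfl
  rw [h1]
  exact h2.trans congr($h3 _)

end Coordinates


section LeviCivita

theorem exists_abs_repr_le {E : Type*} [NormedAddCommGroup E] [NormedSpace ℝ E]
    {ι : Type*} [Fintype ι] (b : Module.Basis ι ℝ E) :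
    ∃ K > 0, ∀ (w : E) i, |b.repr w i| ≤ K * ‖w‖ := by
  have : FiniteDimensional ℝ E := b.finiteDimensional_of_finite
  refine ⟨∑ i, ‖(b.coord i).toContinuousLinearMap‖ + 1, by positivity, fun w i =>
    ((b.coord i).toContinuousLinearMap.le_opNorm w).trans
      (mul_le_mul_of_nonneg_right ?_ (norm_nonneg w))⟩
  have := Finset.single_le_sum (f := fun i => ‖(b.coord i).toContinuousLinearMap‖)
    (fun _ _ => norm_nonneg _) (Finset.mem_univ i)
  linarith

variable {E : Type*} [NormedAddCommGroup E] [NormedSpace ℝ E]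
  {H : Type*} [TopologicalSpace H] {I : ModelWithCorners ℝ E H}
  {M : Type*} [TopologicalSpace M] [ChartedSpace H M] [IsManifold I ∞ M]

section Metric

variable [RiemannianBundle (fun x : M => TangentSpace I x)]
  [IsContMDiffRiemannianBundle I ∞ E (fun x : M => TangentSpace I x)]

theorem isContinuousRiemannianBundle_tangentSpace :
    IsContinuousRiemannianBundle E (fun x : M => TangentSpace I x) := by
  obtain ⟨g, hg, h⟩ := IsContMDiffRiemannianBundle.exists_contMDiff (IB := I) (n := ∞) (F := E)
    (E := fun x : M => TangentSpace I x)
  exact ⟨⟨g, hg.continuous, h⟩⟩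

theorem eventually_norm_chartDeriv_le (q : M) :
    ∃ C > 0, ∀ᶠ p in 𝓝 q, (∀ v : TangentSpace I p, ‖chartDeriv I q p v‖ ≤ C * ‖v‖) ∧
      ∀ u : E, ‖coordField I q u p‖ ≤ C * ‖u‖ := by
  have := isContinuousRiemannianBundle_tangentSpace (I := I) (M := M)
  obtain ⟨C₁, hC₁, h₁⟩ := eventually_norm_trivializationAt_lt E (fun x : M => TangentSpace I x) q
  obtain ⟨C₂, hC₂, h₂⟩ :=
    eventually_norm_symmL_trivializationAt_lt E (fun x : M => TangentSpace I x) q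
  refine ⟨max C₁ C₂, lt_max_of_lt_left hC₁, ?_⟩
  filter_upwards [h₁, h₂] with p hp₁ hp₂
  exact ⟨fun v => ((chartDeriv I q p).le_opNorm v).trans
      (mul_le_mul_of_nonneg_right (hp₁.le.trans (le_max_left _ _)) (norm_nonneg v)),
    fun u => (((trivializationAt E (TangentSpace I : M → Type _) q).symmL ℝ p).le_opNorm u).trans
      (mul_le_mul_of_nonneg_right (hp₂.le.trans (le_max_right _ _)) (norm_nonneg u))⟩

/-- The Gram coefficients of the metric in the chart at `q`. -/
noncomputable def gram (I : ModelWithCorners ℝ E H) {M : Type*} [TopologicalSpace M]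
    [ChartedSpace H M] [IsManifold I ∞ M] [RiemannianBundle (fun x : M => TangentSpace I x)]
    (q : M) (u v : E) (p : M) : ℝ :=
  inner ℝ (coordField I q u p) (coordField I q v p)

theorem contMDiffAt_gram {q p : M} (hp : p ∈ (chartAt H q).source) (u v : E) :
    ContMDiffAt I 𝓘(ℝ, ℝ) ∞ (gram I q u v) p :=
  ContMDiffAt.inner_bundle (b := fun x => x) (contMDiffAt_coordField hp u)
    (contMDiffAt_coordField hp v)

theorem eventually_abs_mvfderiv_gram_le [I.Boundaryless] (q : M) (u v w : E) :
    ∃ C : ℝ, ∀ᶠ p in 𝓝 q, |mvfderiv I (gram I q u v) p (coordField I q w p)| ≤ C := by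
  have h1 : ContDiffAt ℝ ∞ (gram I q u v ∘ (extChartAt I q).symm) (extChartAt I q q) := by
    rw [← contMDiffAt_iff_contDiffAt]
    have hs : ContMDiffAt 𝓘(ℝ, E) I ∞ (extChartAt I q).symm (extChartAt I q q) := by
      have := contMDiffWithinAt_extChartAt_symm_range (n := ∞) (I := I) q (mem_extChartAt_target q)
      rwa [I.range_eq_univ, contMDiffWithinAt_univ] at this
    refine ContMDiffAt.comp _ ?_ hs
    rw [extChartAt_to_inv]
    exact contMDiffAt_gram (mem_chart_source H q) u v
  have h2 : ContinuousAt (fun p => |fderiv ℝ (gram I q u v ∘ (extChartAt I q).symm)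
      (extChartAt I q p) w|) q := by
    have h3 : ContinuousAt (fderiv ℝ (gram I q u v ∘ (extChartAt I q).symm)) (extChartAt I q q) :=
      (h1.fderiv_right (m := 0) (by simp)).continuousAt
    exact ((h3.comp (continuousAt_extChartAt q)).clm_apply continuousAt_const).abs
  obtain ⟨C, hC⟩ := exists_gt |fderiv ℝ (gram I q u v ∘ (extChartAt I q).symm) (extChartAt I q q) w|
  refine ⟨C, ?_⟩
  filter_upwards [(h2.eventually (gt_mem_nhds hC)).and (chart_source_mem_nhds H q)] with p hp
  rw [mvfderiv_coordField hp.2 ((contMDiffAt_gram hp.2 u v).mdifferentiableAt (by simp)),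
    chartDeriv_coordField hp.2]
  exact hp.1.le

variable [FiniteDimensional ℝ E]

/-- The Koszul formula for coordinate fields. -/
theorem IsLeviCivita.two_mul_inner_coordField
    {nabla : CovariantDerivative I E (fun x : M => TangentSpace I x)}
    (h : IsLeviCivita I nabla) {q p : M} (hp : p ∈ (chartAt H q).source) (u v w : E) :
    2 * inner ℝ (nabla (coordField I q v) p (coordField I q u p)) (coordField I q w p) =
      mvfderiv I (gram I q v w) p (coordField I q u p) +
      mvfderiv I (gram I q u w) p (coordField I q v p) -
      mvfderiv I (gram I q u v) p (coordField I q w p) := by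
  have : CompleteSpace E := FiniteDimensional.complete ℝ E
  have hd : ∀ u : E, MDifferentiableAt I I.tangent
      (fun x => (⟨x, coordField I q u x⟩ : TangentBundle I M)) p := fun u =>
    (contMDiffAt_coordField hp u).mdifferentiableAt (by simp)
  have hsymm : ∀ u v : E, nabla (coordField I q v) p (coordField I q u p) =
      nabla (coordField I q u) p (coordField I q v p) := fun u v => by
    have := (CovariantDerivative.torsion_eq_zero_iff nabla).1 h.1 (hd u) (hd v)
    rwa [mlieBracket_coordField hp, sub_eq_zero] at this
  have hmet : ∀ u v w : E, mvfderiv I (gram I q v w) p (coordField I q u p) =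
      inner ℝ (nabla (coordField I q v) p (coordField I q u p)) (coordField I q w p) +
      inner ℝ (coordField I q v p) (nabla (coordField I q w) p (coordField I q u p)) :=
    fun u v w => h.2.mvfderiv_inner_eq (coordField I q u) (hd v) (hd w)
  rw [hmet u v w, hmet v u w, hmet w u v, hsymm v u, hsymm w u, hsymm w v,
    real_inner_comm (coordField I q v p) (nabla (coordField I q w) p (coordField I q u p))]
  ring

/-- The Christoffel symbols of the Levi-Civita connection are locally bounded. -/
theorem IsLeviCivita.eventually_norm_nabla_coordField_le [I.Boundaryless]
    {nabla : CovariantDerivative I E (fun x : M => TangentSpace I x)}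
    (h : IsLeviCivita I nabla) {ι : Type*} [Fintype ι] (b : Module.Basis ι ℝ E) (q : M) :
    ∃ C > 0, ∀ᶠ p in 𝓝 q, ∀ i j,
      ‖chartDeriv I q p (nabla (coordField I q (b i)) p (coordField I q (b j) p))‖ ≤ C := by
  have hg : ∃ D > 0, ∀ᶠ p in 𝓝 q, ∀ ijk : ι × ι × ι,
      |mvfderiv I (gram I q (b ijk.1) (b ijk.2.1)) p (coordField I q (b ijk.2.2) p)| ≤ D := by
    choose D hD using fun ijk : ι × ι × ι =>
      eventually_abs_mvfderiv_gram_le (I := I) q (b ijk.1) (b ijk.2.1) (b ijk.2.2)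
    refine ⟨∑ ijk, |D ijk| + 1, by positivity, ?_⟩
    filter_upwards [eventually_all.2 hD] with p hp ijk
    have := Finset.single_le_sum (f := fun ijk => |D ijk|) (fun _ _ => abs_nonneg _)
      (Finset.mem_univ ijk)
    have h1 := (hp ijk).trans (le_abs_self _)
    linarith
  obtain ⟨D, hD, hg⟩ := hg
  obtain ⟨C₁, hC₁, h₁⟩ := eventually_norm_chartDeriv_le (I := I) q
  obtain ⟨K, hK, hrepr⟩ := exists_abs_repr_le b
  refine ⟨C₁ * (Fintype.card ι * (K * C₁ * (3 / 2 * D))) + 1, by positivity, ?_⟩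
  filter_upwards [hg, h₁, chart_source_mem_nhds H q] with p hgp hp₁ hp i j
  set z := nabla (coordField I q (b i)) p (coordField I q (b j) p)
  have hinner : ∀ k, |inner ℝ z (coordField I q (b k) p)| ≤ 3 / 2 * D := fun k => by
    have h1 := h.two_mul_inner_coordField hp (b j) (b i) (b k)
    have h2 := abs_le.1 (hgp (i, k, j))
    have h3 := abs_le.1 (hgp (j, k, i))
    have h4 := abs_le.1 (hgp (j, i, k))
    simp only at h2 h3 h4
    rw [abs_le]
    constructor <;> linarith
  have hzsum : z = ∑ k, b.repr (chartDeriv I q p z) k • coordField I q (b k) p := by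
    conv_lhs => rw [← coordField_chartDeriv hp z, ← b.sum_repr (chartDeriv I q p z)]
    rw [coordField_sum]
    exact Finset.sum_congr rfl fun k _ => coordField_smul _ _
  have hsq : ‖z‖ * ‖z‖ ≤ (Fintype.card ι * (K * C₁ * (3 / 2 * D))) * ‖z‖ := by
    rw [← real_inner_self_eq_norm_mul_norm]
    conv_lhs => rw [hzsum, sum_inner]
    refine (Finset.sum_le_card_nsmul _ _ (K * C₁ * (3 / 2 * D) * ‖z‖) fun k _ => ?_).trans ?_
    · rw [← hzsum, real_inner_smul_left, real_inner_comm]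
      refine (le_abs_self _).trans ?_
      rw [abs_mul]
      calc _ ≤ (K * (C₁ * ‖z‖)) * (3 / 2 * D) := mul_le_mul
            ((hrepr _ k).trans (mul_le_mul_of_nonneg_left (hp₁.1 z) hK.le)) (hinner k)
            (abs_nonneg _) (by positivity)
        _ = _ := by ring
    · rw [nsmul_eq_mul, Finset.card_univ]
      exact le_of_eq (by ring)
  have hz' : ‖z‖ ≤ Fintype.card ι * (K * C₁ * (3 / 2 * D)) := by
    rcases (norm_nonneg z).eq_or_lt with h0 | h0
    · rw [← h0]; positivity
    · exact le_of_mul_le_mul_right hsq h0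
  have := (hp₁.1 z).trans (mul_le_mul_of_nonneg_left hz' hC₁.le)
  linarith

end Metric

/-- A connection applied to a linear combination of fields with variable coefficients. -/
theorem nabla_sum_smul {nabla : CovariantDerivative I E (fun x : M => TangentSpace I x)} {p : M}
    {ι : Type*} (s : Finset ι) {f : ι → M → ℝ} {σ : ι → (x : M) → TangentSpace I x}
    (hf : ∀ i, MDifferentiableAt I 𝓘(ℝ, ℝ) (f i) p)
    (hσ : ∀ i, MDifferentiableAt I I.tangent (fun x => (⟨x, σ i x⟩ : TangentBundle I M)) p)
    (v : TangentSpace I p) :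
    nabla (fun x => ∑ i ∈ s, f i x • σ i x) p v =
      ∑ i ∈ s, (f i p • nabla (σ i) p v + mvfderiv I (f i) p v • σ i p) := by
  classical
  induction s using Finset.induction_on with
  | empty =>
    simp only [Finset.sum_empty]
    exact congr($(nabla.isCovariantDerivativeOnUniv.zero (mem_univ p)) v)
  | insert i s hi ih =>
    have hsum : MDifferentiableAt I I.tangent
        (fun x => (⟨x, ∑ i ∈ s, f i x • σ i x⟩ : TangentBundle I M)) p :=
      MDifferentiableAt.sum_section fun i _ => (hf i).smul_section (hσ i)
    have hadd := nabla.isCovariantDerivativeOnUniv.add ((hf i).smul_section (hσ i)) hsum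
      (mem_univ p)
    have hleib := nabla.isCovariantDerivativeOnUniv.leibniz (hσ i) (hf i) (mem_univ p)
    simp only [Finset.sum_insert hi]
    rw [← ih]
    refine (congr($hadd v)).trans ?_
    rw [add_apply, hleib]
    rfl

theorem eventually_norm_nabla_sub_fderiv_le [FiniteDimensional ℝ E] [I.Boundaryless]
    [RiemannianBundle (fun x : M => TangentSpace I x)]
    [IsContMDiffRiemannianBundle I ∞ E (fun x : M => TangentSpace I x)]
    {nabla : CovariantDerivative I E (fun x : M => TangentSpace I x)}
    (h : IsLeviCivita I nabla) {F : (x : M) → TangentSpace I x}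
    (hF : IsCnVectorField I 2 F) (q : M) :
    ∃ C > 0, ∀ᶠ p in 𝓝 q, ∀ v : TangentSpace I p,
      ‖chartDeriv I q p (nabla F p v) - fderiv ℝ ((fun x => chartDeriv I q x (F x)) ∘
        (extChartAt I q).symm) (extChartAt I q p) (chartDeriv I q p v)‖ ≤
      C * ‖chartDeriv I q p (F p)‖ * ‖chartDeriv I q p v‖ := by
  set b := Module.finBasis ℝ E
  set f : M → E := fun x => chartDeriv I q x (F x)
  obtain ⟨C₀, hC₀, hΓ⟩ := h.eventually_norm_nabla_coordField_le b q
  obtain ⟨K, hK, hrepr⟩ := exists_abs_repr_le b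
  set n := Fintype.card (Fin (Module.finrank ℝ E))
  refine ⟨n * (K * (n * (K * C₀))) + 1, by positivity, ?_⟩
  filter_upwards [hΓ, chart_source_mem_nhds H q] with p hΓp hp v
  have hf : MDifferentiableAt I 𝓘(ℝ, E) f p :=
    (contMDiffAt_chartDeriv hp (hF p)).mdifferentiableAt (by simp)
  set L : Fin (Module.finrank ℝ E) → E →L[ℝ] ℝ := fun i => (b.coord i).toContinuousLinearMap
  have hfi : ∀ i, MDifferentiableAt I 𝓘(ℝ, ℝ) (L i ∘ f) p := fun i =>
    (L i).differentiable.mdifferentiable.mdifferentiableAt.comp p hf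
  have hs : ∀ i, MDifferentiableAt I I.tangent
      (fun x => (⟨x, coordField I q (b i) x⟩ : TangentBundle I M)) p := fun i =>
    (contMDiffAt_coordField hp (b i)).mdifferentiableAt (by simp)
  have hFsum : ∀ᶠ x in 𝓝 p, F x = ∑ i, (L i ∘ f) x • coordField I q (b i) x := by
    filter_upwards [(chartAt H q).open_source.mem_nhds hp] with x hx
    conv_lhs => rw [← coordField_chartDeriv hx (F x), ← b.sum_repr (chartDeriv I q x (F x)),
      coordField_sum]
    exact Finset.sum_congr rfl fun i _ => coordField_smul _ _
  have hnabla : nabla F p v = ∑ i, ((L i ∘ f) p • nabla (coordField I q (b i)) p v +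
      mvfderiv I (L i ∘ f) p v • coordField I q (b i) p) := by
    rw [← nabla_sum_smul Finset.univ hfi hs v]
    exact congr($(nabla.isCovariantDerivativeOnUniv.congr_of_eventuallyEq
      ((hF p).mdifferentiableAt (by simp))
      (MDifferentiableAt.sum_section fun i _ => (hfi i).smul_section (hs i)) univ_mem hFsum) v)
  set w := chartDeriv I q p v
  have hder : ∀ i, mvfderiv I (L i ∘ f) p v =
      b.repr (fderiv ℝ (f ∘ (extChartAt I q).symm) (extChartAt I q p) w) i := fun i => by
    rw [mvfderiv_coordField hp (hfi i), Function.comp_assoc, fderiv_comp]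
    · rw [ContinuousLinearMap.fderiv]
      rfl
    · exact (L i).differentiableAt
    · exact differentiableAt_comp_extChartAt_symm hp hf
  have hmain : chartDeriv I q p (nabla F p v) - fderiv ℝ (f ∘ (extChartAt I q).symm)
      (extChartAt I q p) w =
      ∑ i, b.repr (f p) i • chartDeriv I q p (nabla (coordField I q (b i)) p v) := by
    rw [hnabla, map_sum, sub_eq_iff_eq_add]
    conv_rhs => rw [← b.sum_repr (fderiv ℝ (f ∘ (extChartAt I q).symm) (extChartAt I q p) w)]
    rw [← Finset.sum_add_distrib]
    refine Finset.sum_congr rfl fun i _ => ?_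
    rw [map_add, map_smul, map_smul, chartDeriv_coordField hp, hder]
    rfl
  have hcol : ∀ i, ‖chartDeriv I q p (nabla (coordField I q (b i)) p v)‖ ≤ n * (K * C₀ * ‖w‖) := by
    intro i
    have hv : v = ∑ j, b.repr w j • coordField I q (b j) p := by
      conv_lhs => rw [← coordField_chartDeriv hp v, ← b.sum_repr (chartDeriv I q p v),
        coordField_sum]
      exact Finset.sum_congr rfl fun j _ => coordField_smul _ _
    rw [hv, map_sum, map_sum]
    refine (norm_sum_le _ _).trans ((Finset.sum_le_card_nsmul _ _ (K * C₀ * ‖w‖)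
      fun j _ => ?_).trans_eq (by rw [nsmul_eq_mul, Finset.card_univ]))
    rw [map_smul, map_smul, norm_smul, Real.norm_eq_abs, mul_right_comm]
    exact mul_le_mul (hrepr w j) (hΓp i j) (norm_nonneg _) (by positivity)
  rw [hmain]
  calc _ ≤ (n : ℝ) * (K * ‖f p‖ * (n * (K * C₀ * ‖w‖))) := by
        refine (norm_sum_le _ _).trans ((Finset.sum_le_card_nsmul _ _ _
          fun i _ => ?_).trans_eq (by rw [nsmul_eq_mul, Finset.card_univ]))
        rw [norm_smul, Real.norm_eq_abs]
        exact mul_le_mul (hrepr _ i) (hcol i) (norm_nonneg _) (by positivity)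
    _ = (n * (K * (n * (K * C₀)))) * ‖f p‖ * ‖w‖ := by ring
    _ ≤ _ := by gcongr; linarith

end LeviCivita


section Retraction

variable {E : Type*} [NormedAddCommGroup E] [NormedSpace ℝ E]
  {H : Type*} [TopologicalSpace H] {I : ModelWithCorners ℝ E H}
  {M : Type*} [TopologicalSpace M] [ChartedSpace H M]

theorem extChartAt_symm_mem_chart_source {q : M} {x : E} (hx : x ∈ (extChartAt I q).target) :
    (extChartAt I q).symm x ∈ (chartAt H q).source := by
  rw [← extChartAt_source (I := I)]
  exact (extChartAt I q).map_target hx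

variable [IsManifold I ∞ M]

theorem coordField_zero (q p : M) : coordField I q 0 p = 0 := map_zero _

/-- The tangent vector with the given base point and components in the chart at `q`. -/
noncomputable def ofCoords (I : ModelWithCorners ℝ E H) {M : Type*} [TopologicalSpace M]
    [ChartedSpace H M] [IsManifold I ∞ M] (q : M) (z : E × E) : TangentBundle I M :=
  ⟨(extChartAt I q).symm z.1, coordField I q z.2 ((extChartAt I q).symm z.1)⟩

theorem ofCoords_extChartAt {q p : M} (hp : p ∈ (chartAt H q).source) (w : E) :
    ofCoords I q (extChartAt I q p, w) = ⟨p, coordField I q w p⟩ := by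
  have h : (extChartAt I q).symm (extChartAt I q p) = p :=
    (extChartAt I q).left_inv (by rwa [extChartAt_source])
  exact congrArg (fun y => (⟨y, coordField I q w y⟩ : TangentBundle I M)) h

theorem IsRetraction.coords_zero {R : TangentBundle I M → M} (hR : IsRetraction I R) (q : M) {x : E}
    (hx : x ∈ (extChartAt I q).target) : extChartAt I q (R (ofCoords I q (x, 0))) = x := by
  simp only [ofCoords, coordField_zero]
  rw [hR.map_zero, (extChartAt I q).right_inv hx]

theorem IsRetraction.hasFDerivAt_coords {R : TangentBundle I M → M} (hR : IsRetraction I R) (q : M)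
    {x : E} (hx : x ∈ (extChartAt I q).target) :
    HasFDerivAt (fun v => extChartAt I q (R (ofCoords I q (x, v)))) (ContinuousLinearMap.id ℝ E)
      0 := by
  set p := (extChartAt I q).symm x
  have hp : p ∈ (chartAt H q).source := extChartAt_symm_mem_chart_source hx
  let B : E →L[ℝ] E := (trivializationAt E (TangentSpace I : M → Type _) q).symmL ℝ p
  have hB0 : B 0 = 0 := _root_.map_zero B
  have h1 : HasMFDerivAt 𝓘(ℝ, E) I (fun v : E => R ⟨p, (v : TangentSpace I p)⟩) (B 0)
      (ContinuousLinearMap.id ℝ E) := by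
    rw [hB0]
    exact hR.hasMFDerivAt_zero p
  have h2 : HasMFDerivAt 𝓘(ℝ, E) I (fun v : E => R (ofCoords I q (x, v))) 0
      ((ContinuousLinearMap.id ℝ E).comp B) :=
    HasMFDerivAt.comp (g := fun v : E => R ⟨p, (v : TangentSpace I p)⟩) (f := B) (0 : E) h1
      (B.hasMFDerivAt (x := (0 : E)))
  have hR0 : R (ofCoords I q (x, 0)) = p := by
    simp only [ofCoords, coordField_zero]
    exact hR.map_zero p
  have h3 : HasMFDerivAt I 𝓘(ℝ, E) (extChartAt I q) (R (ofCoords I q (x, 0)))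
      (mfderiv I 𝓘(ℝ, E) (extChartAt I q) p) := by
    rw [hR0]
    exact (mdifferentiableAt_extChartAt hp).hasMFDerivAt
  have h4 := (h3.comp (0 : E) h2).hasFDerivAt
  refine h4.congr_fderiv ?_
  ext v
  have h5 := chartDeriv_coordField (I := I) hp v
  rw [chartDeriv_eq_mvfderiv hp] at h5
  exact h5

variable [I.Boundaryless]

theorem contMDiffAt_ofCoords (q : M) :
    ContMDiffAt 𝓘(ℝ, E × E) I.tangent ∞ (ofCoords I q) (extChartAt I q q, 0) := by
  have hs : ContMDiffAt 𝓘(ℝ, E) I ∞ (extChartAt I q).symm (extChartAt I q q) := by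
    have := contMDiffWithinAt_extChartAt_symm_range (n := ∞) (I := I) q (mem_extChartAt_target q)
    rwa [I.range_eq_univ, contMDiffWithinAt_univ] at this
  have hfst : ContMDiffAt 𝓘(ℝ, E × E) 𝓘(ℝ, E) ∞ Prod.fst (extChartAt I q q, (0 : E)) :=
    contDiffAt_fst.contMDiffAt
  have hsnd : ContMDiffAt 𝓘(ℝ, E × E) 𝓘(ℝ, E) ∞ Prod.snd (extChartAt I q q, (0 : E)) :=
    contDiffAt_snd.contMDiffAt
  refine ((trivializationAt E (TangentSpace I : M → Type _) q).contMDiffAt_iff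
    (f := ofCoords I q) ?_).2 ⟨ContMDiffAt.comp (g := (extChartAt I q).symm)
      (f := Prod.fst) (extChartAt I q q, (0 : E)) hs hfst,
      hsnd.congr_of_eventuallyEq ?_⟩
  · exact (Trivialization.mem_source _).2
      (extChartAt_symm_mem_chart_source (mem_extChartAt_target q))
  · have htarget : ∀ᶠ z : E × E in 𝓝 (extChartAt I q q, (0 : E)), z.1 ∈ (extChartAt I q).target :=
      continuousAt_fst.eventually (extChartAt_target_mem_nhds q)
    filter_upwards [htarget] with z hz
    have hz' := extChartAt_symm_mem_chart_source hz
    exact (chartDeriv_eq_trivializationAt hz' _).symm.trans (chartDeriv_coordField hz' _)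

theorem IsRetraction.contDiffAt_coords {R : TangentBundle I M → M} (hR : IsRetraction I R) (q : M) :
    ContDiffAt ℝ ∞ (fun z => extChartAt I q (R (ofCoords I q z))) (extChartAt I q q, 0) := by
  rw [← contMDiffAt_iff_contDiffAt]
  have h0 : R (ofCoords I q (extChartAt I q q, 0)) = q := by
    simp only [ofCoords, coordField_zero]
    exact (hR.map_zero _).trans (extChartAt_to_inv q)
  have h1 : ContMDiffAt 𝓘(ℝ, E × E) I ∞ (fun z => R (ofCoords I q z)) (extChartAt I q q, 0) :=
    (hR.smooth _).comp _ (contMDiffAt_ofCoords q)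
  refine ContMDiffAt.comp (g := extChartAt I q) _ ?_ h1
  rw [h0]
  exact contMDiffAt_extChartAt

end Retraction


theorem sq_add_mul_add_le {a b c d m : ℝ} (hc : 0 ≤ c) (hd : 0 ≤ d) (hb : 0 ≤ b) (hbd : b ≤ c * d)
    (ha : 0 ≤ a) (hm : 0 ≤ m) :
    b ^ 2 + a * b + m ≤ (c ^ 2 + c + 1) * (d ^ 2 + a * d + m) := by
  have h1 : b ^ 2 ≤ (c * d) ^ 2 := pow_le_pow_left₀ hb hbd 2
  have h2 : a * b ≤ a * (c * d) := mul_le_mul_of_nonneg_left hbd ha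
  have h3 : 0 ≤ (c ^ 2 + 1) * (a * d) := by positivity
  have h4 : 0 ≤ (c ^ 2 + c) * m := by positivity
  have h5 : 0 ≤ (c + 1) * d ^ 2 := by positivity
  linarith

section LocalEstimate

variable {E : Type*} [NormedAddCommGroup E] [NormedSpace ℝ E] [FiniteDimensional ℝ E]
  {H : Type*} [TopologicalSpace H] {I : ModelWithCorners ℝ E H} [I.Boundaryless]
  {M : Type*} [MetricSpace M] [ChartedSpace H M] [IsManifold I ∞ M]
  [RiemannianBundle (fun x : M => TangentSpace I x)]
  [IsContMDiffRiemannianBundle I ∞ E (fun x : M => TangentSpace I x)]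
  [IsRiemannianManifold I M]

/-- Near a nondegenerate zero `q` of `F`, one damped perturbed Newton step from `p` ends at distance
`O(d² + (1 - α) d + μ)` from `q`, where `d` is the distance of `p` to `q`. -/
theorem exists_damped_newton_step_estimate
    {nabla : CovariantDerivative I E (fun x : M => TangentSpace I x)}
    (hnabla : IsLeviCivita I nabla) {R : TangentBundle I M → M} (hR : IsRetraction I R)
    {F : (x : M) → TangentSpace I x} (hF : IsCnVectorField I 2 F) {q : M} (hzero : F q = 0)
    (hnonsing : Function.Bijective (nabla F q))
    {e : (x : M) → TangentSpace I x} (he : ∃ C : ℝ, ∀ᶠ x in 𝓝 q, ‖e x‖ ≤ C) :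
    ∃ C > 0, ∃ r > 0, ∃ m₀ > 0, ∀ p, dist p q < r →
      Function.Bijective (nabla F p) ∧ ‖F p‖ ≤ C * dist p q ∧
      ∀ (ξ : TangentSpace I p) (μ α : ℝ), 0 < μ → μ ≤ m₀ → 0 < α → α ≤ 1 →
        nabla F p ξ = -F p + μ • e p →
        dist (R ⟨p, α • ξ⟩) q ≤ C * (dist p q ^ 2 + (1 - α) * dist p q + μ) := by
  have : CompleteSpace E := FiniteDimensional.complete ℝ E
  have := isContinuousRiemannianBundle_tangentSpace (I := I) (M := M)
  have : IsManifold I 1 M := IsManifold.of_le (n := ∞) (by norm_cast)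
  set φ := extChartAt I q
  set x₀ := φ q with hx₀
  set f : M → E := fun x => chartDeriv I q x (F x) with hf
  set g : E → E := f ∘ φ.symm
  have hgφ : ∀ p ∈ (chartAt H q).source, g (φ p) = f p := fun p hp =>
    congrArg f (φ.left_inv (by rwa [extChartAt_source]))
  obtain ⟨C₁, hC₁, hcoord⟩ := eventually_norm_chartDeriv_le (I := I) q
  obtain ⟨C₂, hC₂, hder⟩ := eventually_norm_nabla_sub_fderiv_le hnabla hF q
  obtain ⟨C₃, he⟩ := he
  obtain ⟨C₄, hC₄, hdist⟩ := exists_dist_extChartAt_comparable I q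
  have hfq : f q = 0 := by rw [hf]; simp only [hzero, map_zero]
  have hg2 : ContDiffAt ℝ 2 g x₀ := by
    rw [← contMDiffAt_iff_contDiffAt]
    have hs : ContMDiffAt 𝓘(ℝ, E) I 2 φ.symm x₀ := by
      have := contMDiffWithinAt_extChartAt_symm_range (n := 2) (I := I) q (mem_extChartAt_target q)
      rwa [I.range_eq_univ, contMDiffWithinAt_univ] at this
    refine ContMDiffAt.comp (g := f) _ ?_ hs
    rw [hx₀, extChartAt_to_inv]
    exact contMDiffAt_chartDeriv (n := 2) (mem_chart_source H q) (hF q)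
  have hg0 : g x₀ = 0 := by rw [hgφ q (mem_chart_source H q), hfq]
  have hinj : Function.Injective (fderiv ℝ g x₀) := by
    rw [injective_iff_map_eq_zero]
    intro w hw
    have h1 := hder.self_of_nhds (coordField I q w q)
    rw [chartDeriv_coordField (mem_chart_source H q)] at h1
    change ‖chartDeriv I q q (nabla F q (coordField I q w q)) - fderiv ℝ g x₀ w‖ ≤
      C₂ * ‖f q‖ * ‖w‖ at h1
    rw [hw, hfq, norm_zero, mul_zero, zero_mul, sub_zero, norm_le_zero_iff] at h1
    have h2 : nabla F q (coordField I q w q) = 0 := by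
      rw [← coordField_chartDeriv (mem_chart_source H q) (nabla F q _), h1, coordField_zero]
    have h3 : coordField I q w q = 0 := hnonsing.1 (h2.trans (map_zero _).symm)
    rw [← chartDeriv_coordField (I := I) (mem_chart_source H q) w, h3, map_zero]
  set C₀ := max C₂ (C₁ * C₃)
  have hC₀pos : 0 < C₀ := lt_max_of_lt_left hC₂
  obtain ⟨C₅, hC₅, r₅, hr₅, hnewton⟩ := exists_newton_step_estimate hg2 hg0 hinj hC₀pos.le
  have htarget : ∀ᶠ x in 𝓝 x₀, x ∈ φ.target := extChartAt_target_mem_nhds q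
  obtain ⟨L, hL, r₆, hr₆, hretr⟩ := exists_norm_retraction_sub_le
    (ρ := fun z => φ (R (ofCoords I q z))) ((hR.contDiffAt_coords q).of_le (by norm_cast))
    (htarget.mono fun x hx => hR.coords_zero q hx)
    (htarget.mono fun x hx => hR.hasFDerivAt_coords q hx)
  obtain ⟨r₇, hr₇, hnear⟩ : ∃ r > 0, ∀ x v, ‖x - x₀‖ < r → ‖v‖ < r →
      dist (R (ofCoords I q (x, v))) q ≤ C₄ * ‖φ (R (ofCoords I q (x, v))) - x₀‖ := by
    have h1 : ContinuousAt (fun z => R (ofCoords I q z)) (x₀, 0) :=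
      ((hR.smooth _).comp _ (contMDiffAt_ofCoords q)).continuousAt
    have h0 : R (ofCoords I q (x₀, 0)) = q := by
      simp only [ofCoords, coordField_zero]
      exact (hR.map_zero _).trans (extChartAt_to_inv q)
    have h2 := h1.eventually (p := fun y => dist y q ≤ C₄ * ‖φ y - x₀‖)
      (by
        change ∀ᶠ y in 𝓝 (R (ofCoords I q (x₀, 0))), _
        rw [h0]
        exact hdist.mono fun y hy => hy.2)
    obtain ⟨r, hr, hball⟩ := Metric.eventually_nhds_iff.1 h2
    refine ⟨r, hr, fun x v hx hv => hball ?_⟩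
    rw [dist_eq_norm, Prod.mk_sub_mk, Prod.norm_mk, sub_zero]
    exact max_lt hx hv
  set s := min r₆ r₇ with hs
  have hspos : 0 < s := lt_min hr₆ hr₇
  set t := s / (2 * (C₅ + 1)) with ht
  have htpos : 0 < t := by positivity
  have hts : C₅ * (t + t) < s := by
    have : (C₅ + 1) * (t + t) = s := by rw [ht]; field_simp; ring
    linarith
  set C₆ := 2 * L * C₅ ^ 2 + C₅ + 1 with hC₆
  have hC₆pos : 0 < C₆ := by positivity
  set C := C₄ * C₆ * (C₄ ^ 2 + C₄ + 1) + C₁ * C₅ * C₄ with hC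
  have hφnear : ∀ᶠ p in 𝓝 q, ‖φ p - x₀‖ < min r₅ (min s t) := by
    have h1 : ContinuousAt (fun p => ‖φ p - x₀‖) q :=
      ((continuousAt_extChartAt q).sub continuousAt_const).norm
    refine h1.eventually (gt_mem_nhds ?_)
    change ‖φ q - φ q‖ < _
    rw [sub_self, norm_zero]
    positivity
  have hsource : ∀ᶠ p in 𝓝 q, p ∈ (chartAt H q).source := chart_source_mem_nhds H q
  obtain ⟨r, hr, hball⟩ := Metric.eventually_nhds_iff.1
    ((hsource.and (hcoord.and (hder.and (he.and hdist)))).and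
      hφnear)
  refine ⟨C, by positivity, r, hr, min 1 t, by positivity, fun p hp => ?_⟩
  obtain ⟨⟨hps, ⟨hc₁, hc₂⟩, hd, hep, hd₁, hd₂⟩, hφp⟩ := hball hp
  have hxr₅ : ‖φ p - x₀‖ < r₅ := hφp.trans_le (min_le_left _ _)
  have hxs : ‖φ p - x₀‖ < s := hφp.trans_le ((min_le_right _ _).trans (min_le_left _ _))
  have hxt : ‖φ p - x₀‖ < t := hφp.trans_le ((min_le_right _ _).trans (min_le_right _ _))
  obtain ⟨hgle, hN⟩ := hnewton (φ p) hxr₅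
  rw [hgφ p hps] at hgle hN
  let B : E →L[ℝ] TangentSpace I p :=
    (trivializationAt E (TangentSpace I : M → Type _) q).symmL ℝ p
  let N : E →L[ℝ] E := (chartDeriv I q p).comp ((nabla F p).comp B)
  have hNapp : ∀ w, N w = chartDeriv I q p (nabla F p (coordField I q w p)) := fun _ => rfl
  obtain ⟨hbij, hstep⟩ := hN N (by
    refine ContinuousLinearMap.opNorm_le_bound _ (by positivity) fun w => ?_
    have h1 := hd (coordField I q w p)
    rw [chartDeriv_coordField hps] at h1
    refine h1.trans (mul_le_mul_of_nonneg_right (mul_le_mul_of_nonneg_right (le_max_left _ _)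
      (norm_nonneg _)) (norm_nonneg _)))
  have hd0 : 0 ≤ dist p q := dist_nonneg
  have hn0 : 0 ≤ ‖φ p - x₀‖ := norm_nonneg _
  refine ⟨⟨fun v v' hv => ?_, fun v => ?_⟩, ?_, fun ξ μ α hμ hμ' hα hα' hξ => ?_⟩
  · rw [← coordField_chartDeriv hps v, ← coordField_chartDeriv hps v'] at hv ⊢
    exact congrArg (fun w => coordField I q w p) (hbij.1 (congrArg (chartDeriv I q p) hv))
  · obtain ⟨w, hw⟩ := hbij.2 (chartDeriv I q p v)
    refine ⟨coordField I q w p, ?_⟩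
    rw [← coordField_chartDeriv hps (nabla F p _), ← hNapp, hw, coordField_chartDeriv hps]
  · have h1 := hc₂ (f p)
    rw [coordField_chartDeriv hps] at h1
    calc ‖F p‖ ≤ C₁ * (C₅ * (C₄ * dist p q)) := h1.trans
          (mul_le_mul_of_nonneg_left (hgle.trans (mul_le_mul_of_nonneg_left hd₁ hC₅.le)) hC₁.le)
      _ = C₁ * C₅ * C₄ * dist p q := by ring
      _ ≤ C * dist p q := by
        refine mul_le_mul_of_nonneg_right ?_ hd0
        have : 0 ≤ C₄ * C₆ * (C₄ ^ 2 + C₄ + 1) := by positivity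
        linarith
  · set w := chartDeriv I q p ξ with hw
    have hNw : N w = -f p + μ • chartDeriv I q p (e p) := by
      rw [hNapp, hw, coordField_chartDeriv hps, hξ, map_add, map_neg, map_smul]
    have hη : ‖chartDeriv I q p (e p)‖ ≤ C₀ :=
      ((hc₁ (e p)).trans (mul_le_mul_of_nonneg_left hep hC₁.le)).trans (le_max_right _ _)
    obtain ⟨hw₁, hw₂⟩ := hstep w _ μ hμ.le hη hNw
    have hμ1 : μ ≤ 1 := hμ'.trans (min_le_left _ _)
    have hws : ‖w‖ < s := hw₂.trans_lt ((mul_le_mul_of_nonneg_left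
      (add_le_add hxt.le (hμ'.trans (min_le_right _ _))) hC₅.le).trans_lt hts)
    have hαw : ‖α • w‖ ≤ ‖w‖ := by
      rw [norm_smul, Real.norm_eq_abs, abs_of_pos hα]
      exact mul_le_of_le_one_left (norm_nonneg _) hα'
    have hpt : R (ofCoords I q (φ p, α • w)) = R ⟨p, α • ξ⟩ := by
      have h2 : coordField I q (α • w) p = α • ξ := by
        rw [coordField_smul, hw, coordField_chartDeriv hps]
      rw [← h2]
      exact congrArg R (ofCoords_extChartAt hps _)
    have h₁ := hretr (φ p) (α • w) (hxs.trans_le (min_le_left _ _))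
      ((hαw.trans_lt hws).trans_le (min_le_left _ _))
    have h₂ := hnear (φ p) (α • w) (hxs.trans_le (min_le_right _ _))
      ((hαw.trans_lt hws).trans_le (min_le_right _ _))
    simp only [hpt] at h₁ h₂
    set d := ‖φ p - x₀‖
    have hα1 : 0 ≤ 1 - α := by linarith
    have hw2 : ‖α • w‖ ^ 2 ≤ 2 * C₅ ^ 2 * (d ^ 2 + μ) := by
      have h3 : ‖α • w‖ ^ 2 ≤ (C₅ * (d + μ)) ^ 2 :=
        pow_le_pow_left₀ (norm_nonneg _) (hαw.trans hw₂) 2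
      have h4 : (d + μ) ^ 2 ≤ 2 * (d ^ 2 + μ) := by nlinarith [sq_nonneg (d - μ)]
      calc _ ≤ C₅ ^ 2 * (d + μ) ^ 2 := by rw [← mul_pow]; exact h3
        _ ≤ C₅ ^ 2 * (2 * (d ^ 2 + μ)) := by gcongr
        _ = _ := by ring
    have hφstep : ‖φ (R ⟨p, α • ξ⟩) - x₀‖ ≤ C₆ * (d ^ 2 + (1 - α) * d + μ) := by
      have e1 : φ (R ⟨p, α • ξ⟩) - x₀ = (φ (R ⟨p, α • ξ⟩) - φ p - α • w) +
          (1 - α) • (φ p - x₀) + α • (φ p - x₀ + w) := by module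
      rw [e1]
      refine norm_add₃_le.trans ?_
      have h3 : ‖(1 - α) • (φ p - x₀)‖ = (1 - α) * d := by
        rw [norm_smul, Real.norm_eq_abs, abs_of_nonneg hα1]
      have h4 : ‖α • (φ p - x₀ + w)‖ ≤ C₅ * (d ^ 2 + μ) := by
        rw [norm_smul, Real.norm_eq_abs, abs_of_pos hα]
        exact (mul_le_of_le_one_left (norm_nonneg _) hα').trans hw₁
      have h5 : L * ‖α • w‖ ^ 2 ≤ L * (2 * C₅ ^ 2 * (d ^ 2 + μ)) :=
        mul_le_mul_of_nonneg_left hw2 hL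
      have h6 : 0 ≤ (2 * L * C₅ ^ 2 + C₅) * ((1 - α) * d) := by positivity
      have h7 : 0 ≤ d ^ 2 + μ := by positivity
      rw [h3, hC₆]
      linarith
    calc dist (R ⟨p, α • ξ⟩) q ≤ C₄ * (C₆ * (d ^ 2 + (1 - α) * d + μ)) :=
          h₂.trans (mul_le_mul_of_nonneg_left hφstep hC₄.le)
      _ ≤ C₄ * (C₆ * ((C₄ ^ 2 + C₄ + 1) * (dist p q ^ 2 + (1 - α) * dist p q + μ))) :=
        mul_le_mul_of_nonneg_left (mul_le_mul_of_nonneg_left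
          (sq_add_mul_add_le hC₄.le hd0 hn0 hd₁ hα1 hμ.le) hC₆pos.le) hC₄.le
      _ ≤ C * (dist p q ^ 2 + (1 - α) * dist p q + μ) := by
        have h1 : 0 ≤ dist p q ^ 2 + (1 - α) * dist p q + μ := by positivity
        have h2 : 0 ≤ C₁ * C₅ * C₄ * (dist p q ^ 2 + (1 - α) * dist p q + μ) := by positivity
        rw [hC, add_mul]
        linarith

end LocalEstimate


section Convergence

variable {E : Type*} [NormedAddCommGroup E] [NormedSpace ℝ E]
  {H : Type*} [TopologicalSpace H] (I : ModelWithCorners ℝ E H)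
  {M : Type*} [MetricSpace M] [ChartedSpace H M] [IsManifold I ∞ M]

/-- One iteration of the method, with index `k`, leads from `p` to `p'`. -/
def IsStep (nabla : CovariantDerivative I E (fun x : M => TangentSpace I x))
    (F e : (x : M) → TangentSpace I x) (R : TangentBundle I M → M) (A : ParameterRule M)
    (k : ℕ) (p p' : M) : Prop :=
  ∃ (ξ : TangentSpace I p) (μ α : ℝ), 0 < μ ∧ 0 < α ∧ α ≤ 1 ∧ (μ, α) ∈ A k p ∧
    nabla F p ξ = -F p + μ • e p ∧ p' = R ⟨p, α • ξ⟩

/-- One iteration from a point near `q` obeys the basic error estimate. -/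
def StepEstimate [RiemannianBundle (fun x : M => TangentSpace I x)]
    (nabla : CovariantDerivative I E (fun x : M => TangentSpace I x))
    (F e : (x : M) → TangentSpace I x) (R : TangentBundle I M → M) (q : M) (C r m₀ : ℝ) : Prop :=
  ∀ p, dist p q < r → Function.Bijective (nabla F p) ∧ ‖F p‖ ≤ C * dist p q ∧
    ∀ (ξ : TangentSpace I p) (μ α : ℝ), 0 < μ → μ ≤ m₀ → 0 < α → α ≤ 1 →
      nabla F p ξ = -F p + μ • e p →
      dist (R ⟨p, α • ξ⟩) q ≤ C * (dist p q ^ 2 + (1 - α) * dist p q + μ)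

variable {I} {nabla : CovariantDerivative I E (fun x : M => TangentSpace I x)}
  {F e : (x : M) → TangentSpace I x} {R : TangentBundle I M → M} {A : ParameterRule M}

theorem IsRun.isStep {p : ℕ → M} {ξ : (k : ℕ) → TangentSpace I (p k)} {μ α : ℕ → ℝ} {n : ℕ}
    (h : IsRun I nabla F e R p ξ μ α n) (hA : Obeys A p μ α n) {k : ℕ} (hk : k < n) :
    IsStep I nabla F e R A k (p k) (p (k + 1)) :=
  ⟨ξ k, μ k, α k, h.mu_pos k hk, h.alpha_pos k hk, h.alpha_le k hk, hA k hk, h.newton k hk,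
    h.step k hk⟩

variable [RiemannianBundle (fun x : M => TangentSpace I x)] {q : M} {C r m₀ : ℝ}

theorem StepEstimate.isStep_near (hest : StepEstimate I nabla F e R q C r m₀) (hC : 0 < C)
    (hr : 0 < r) (hm₀ : 0 < m₀) (hA : MuVanishesAt A q) (k : ℕ) {η : ℝ} (hη : 0 < η) :
    ∃ δ > 0, ∀ p p', dist p q < δ → IsStep I nabla F e R A k p p' → dist p' q < η := by
  obtain ⟨δ, hδ, hball⟩ := Metric.eventually_nhds_iff.1 (hA k (min m₀ (η / (4 * C)))
    (by positivity))
  refine ⟨min δ (min r (min 1 (η / (4 * C)))), by positivity, ?_⟩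
  rintro p p' hp ⟨ξ, μ, α, hμ, hα, hα', hmem, hnewton, rfl⟩
  simp only [lt_min_iff] at hp
  have hμ' := hball hp.1 μ α hmem
  have h1 := (hest p hp.2.1).2.2 ξ μ α hμ (hμ'.trans (min_le_left _ _)) hα hα' hnewton
  have h2 : μ ≤ η / (4 * C) := hμ'.trans (min_le_right _ _)
  have hd : 0 ≤ dist p q := dist_nonneg
  have h3 : C * (η / (4 * C)) = η / 4 := by field_simp
  have h4 : dist p q ^ 2 + (1 - α) * dist p q + μ < 4 * (η / (4 * C)) := by
    nlinarith [hp.2.2.1, hp.2.2.2]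
  have h5 := mul_lt_mul_of_pos_left h4 hC
  linarith

/-- Under the superlinear scheme, a late iteration near `q` reduces the distance to `q` by any
prescribed factor. -/
theorem StepEstimate.isStep_contract (hest : StepEstimate I nabla F e R q C r m₀) (hC : 0 < C)
    (hr : 0 < r) (hm₀ : 0 < m₀) (hs : IsSuperlinearScheme I F A q) {c : ℝ} (hc : 0 < c) :
    ∃ K : ℕ, ∃ s > 0, s ≤ r ∧ ∀ k ≥ K, ∀ p p', dist p q < s →
      IsStep I nabla F e R A k p p' → dist p' q ≤ c * dist p q := by
  set ε := min (c / (4 * C)) (c / (4 * C ^ 2))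
  have hεpos : 0 < ε := by positivity
  obtain ⟨P, hP, Q, hQ, hPQ⟩ := eventually_prod_iff.1 (hs ε hεpos)
  obtain ⟨K, hK⟩ := eventually_atTop.1 hP
  obtain ⟨δ, hδ, hball⟩ := Metric.eventually_nhds_iff.1 hQ
  refine ⟨K, min r (min δ (min (c / (4 * C)) (m₀ / (ε * C)))), by positivity, min_le_left _ _,
    ?_⟩
  rintro k hk p p' hp ⟨ξ, μ, α, hμ, hα, hα', hmem, hnewton, rfl⟩
  simp only [lt_min_iff] at hp
  obtain ⟨hpr, hpδ, hpc, hpm⟩ := hp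
  obtain ⟨h1, h2⟩ := hPQ (hK k hk) (hball hpδ) μ α hmem
  obtain ⟨-, hF, hstep⟩ := hest p hpr
  have hd : 0 ≤ dist p q := dist_nonneg
  have hμ₁ : μ ≤ ε * C * dist p q := by
    rw [mul_assoc]; exact h1.trans (mul_le_mul_of_nonneg_left hF hεpos.le)
  have hμ₂ : μ ≤ m₀ := by
    rw [lt_div_iff₀ (by positivity)] at hpm
    linarith
  refine (hstep ξ μ α hμ hμ₂ hα hα' hnewton).trans ?_
  have hε₁ : ε * C ≤ c / 4 := by
    have := mul_le_mul_of_nonneg_right (min_le_left (c / (4 * C)) (c / (4 * C ^ 2))) hC.le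
    refine this.trans_eq ?_
    field_simp
  have hε₂ : ε * C ^ 2 ≤ c / 4 := by
    have := mul_le_mul_of_nonneg_right (min_le_right (c / (4 * C)) (c / (4 * C ^ 2)))
      (sq_nonneg C)
    refine this.trans_eq ?_
    field_simp
  have hdC : dist p q * C ≤ c / 4 := by
    have := mul_le_mul_of_nonneg_right hpc.le hC.le
    refine this.trans_eq ?_
    field_simp
  have e1 : C * dist p q ^ 2 ≤ c / 4 * dist p q := by
    rw [sq, ← mul_assoc, mul_comm C]
    exact mul_le_mul_of_nonneg_right hdC hd
  have e2 : C * ((1 - α) * dist p q) ≤ c / 4 * dist p q := by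
    rw [← mul_assoc]
    refine mul_le_mul_of_nonneg_right (le_trans ?_ hε₁) hd
    rw [mul_comm]
    exact mul_le_mul_of_nonneg_right h2 hC.le
  have e3 : C * μ ≤ c / 4 * dist p q := by
    calc C * μ ≤ C * (ε * C * dist p q) := mul_le_mul_of_nonneg_left hμ₁ hC.le
      _ = ε * C ^ 2 * dist p q := by ring
      _ ≤ _ := mul_le_mul_of_nonneg_right hε₂ hd
  have e4 : 0 ≤ c * dist p q := by positivity
  linarith

theorem StepEstimate.exists_convergence (hest : StepEstimate I nabla F e R q C r m₀) (hC : 0 < C)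
    (hr : 0 < r) (hm₀ : 0 < m₀) (hA : MuVanishesAt A q) (hs : IsSuperlinearScheme I F A q) :
    ∃ δ > 0, ∀ (p : ℕ → M) (ξ : (k : ℕ) → TangentSpace I (p k)) (μ α : ℕ → ℝ),
      dist (p 0) q < δ →
      (∀ n, IsRun I nabla F e R p ξ μ α n → Obeys A p μ α n →
        Function.Bijective (nabla F (p n))) ∧
      ((∀ n, IsRun I nabla F e R p ξ μ α n ∧ Obeys A p μ α n) → Tendsto p atTop (𝓝 q)) := by
  obtain ⟨K, s, hs₀, hsr, hK⟩ := hest.isStep_contract hC hr hm₀ hs (c := 1 / 2) (by norm_num)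
  obtain ⟨δ, hδ, H⟩ := exists_forall_dist_lt_of_steps
    (fun k η hη => hest.isStep_near hC hr hm₀ hA k hη) hs₀
    (K := K) (fun k hk p p' hp hstep => (hK k hk p p' hp hstep).trans_eq (by ring))
  refine ⟨δ, hδ, fun p ξ μ α hp => ⟨fun n hrun hobey => ?_, fun hrun => ?_⟩⟩
  · exact (hest (p n) (((H p hp).1 n fun k hk => hrun.isStep hobey hk).trans_le hsr)).1
  · exact (H p hp).2 fun k => (hrun (k + 1)).1.isStep (hrun (k + 1)).2 (Nat.lt_succ_self k)

theorem StepEstimate.convergesSuperlinearly (hest : StepEstimate I nabla F e R q C r m₀)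
    (hC : 0 < C) (hr : 0 < r) (hm₀ : 0 < m₀) (hs : IsSuperlinearScheme I F A q) {p : ℕ → M}
    (hstep : ∀ k, IsStep I nabla F e R A k (p k) (p (k + 1))) (hp : Tendsto p atTop (𝓝 q)) :
    ConvergesSuperlinearly p q := by
  refine ⟨hp, Asymptotics.isLittleO_iff.2 fun c hc => ?_⟩
  obtain ⟨K, s, hs₀, -, hK⟩ := hest.isStep_contract hC hr hm₀ hs hc
  filter_upwards [eventually_ge_atTop K, hp.eventually (Metric.ball_mem_nhds q hs₀)] with k hk hpk
  simpa using hK k hk _ _ hpk (hstep k)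

theorem StepEstimate.convergesQuadratically (hest : StepEstimate I nabla F e R q C r m₀)
    (hC : 0 < C) (hr : 0 < r) (hm₀ : 0 < m₀) (hs : IsQuadraticScheme I F A q) {p : ℕ → M}
    (hstep : ∀ k, IsStep I nabla F e R A k (p k) (p (k + 1))) (hp : Tendsto p atTop (𝓝 q)) :
    ConvergesQuadratically p q := by
  obtain ⟨B, hB⟩ := hs
  set D := |B|
  have hD0 : 0 ≤ D := abs_nonneg B
  refine ⟨hp, Asymptotics.IsBigO.of_bound (C * (1 + D * C + D * C ^ 2)) ?_⟩
  have hdist : Tendsto (fun k => D * C ^ 2 * dist (p k) q ^ 2) atTop (𝓝 0) := by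
    have := ((tendsto_iff_dist_tendsto_zero.1 hp).pow 2).const_mul (D * C ^ 2)
    simpa using this
  filter_upwards [(tendsto_id.prodMk hp).eventually hB, hp.eventually (Metric.ball_mem_nhds q hr),
    hdist.eventually (gt_mem_nhds hm₀)] with k hk hpk hsmall
  obtain ⟨ξ, μ, α, hμ, hα, hα', hmem, hnewton, hnext⟩ := hstep k
  obtain ⟨h1, h2⟩ := hk μ α hmem
  obtain ⟨-, hF, hest'⟩ := hest (p k) hpk
  have hd : 0 ≤ dist (p k) q := dist_nonneg
  have hμ₁ : μ ≤ D * C ^ 2 * dist (p k) q ^ 2 := by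
    calc μ ≤ B * ‖F (p k)‖ ^ 2 := h1
      _ ≤ D * ‖F (p k)‖ ^ 2 := mul_le_mul_of_nonneg_right (le_abs_self B) (sq_nonneg _)
      _ ≤ D * (C * dist (p k) q) ^ 2 :=
        mul_le_mul_of_nonneg_left (pow_le_pow_left₀ (norm_nonneg _) hF 2) hD0
      _ = _ := by ring
  have hα₁ : 1 - α ≤ D * C * dist (p k) q := by
    calc 1 - α ≤ B * ‖F (p k)‖ := h2
      _ ≤ D * ‖F (p k)‖ := mul_le_mul_of_nonneg_right (le_abs_self B) (norm_nonneg _)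
      _ ≤ D * (C * dist (p k) q) := mul_le_mul_of_nonneg_left hF hD0
      _ = _ := by ring
  have h3 := hest' ξ μ α hμ (hμ₁.trans hsmall.le) hα hα' hnewton
  rw [hnext, Real.norm_eq_abs, Real.norm_eq_abs, abs_of_nonneg dist_nonneg,
    abs_of_nonneg (sq_nonneg _), mul_assoc]
  refine h3.trans (mul_le_mul_of_nonneg_left ?_ hC.le)
  have h4 := mul_le_mul_of_nonneg_right hα₁ hd
  nlinarith

/-- A quadratic scheme is a superlinear one. -/
theorem IsQuadraticScheme.isSuperlinearScheme (hest : StepEstimate I nabla F e R q C r m₀)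
    (hr : 0 < r) (hs : IsQuadraticScheme I F A q) : IsSuperlinearScheme I F A q := by
  obtain ⟨B, hB⟩ := hs
  intro ε hε
  have hF : Tendsto (fun p => ‖F p‖) (𝓝 q) (𝓝 0) := by
    have h1 : Tendsto (fun p => C * dist p q) (𝓝 q) (𝓝 0) := by
      have := (tendsto_iff_dist_tendsto_zero.1 (tendsto_id (x := 𝓝 q))).const_mul C
      simpa using this
    refine squeeze_zero' (Eventually.of_forall fun _ => norm_nonneg _) ?_ h1
    filter_upwards [Metric.ball_mem_nhds q hr] with p hp
    exact (hest p hp).2.1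
  have hBF : ∀ᶠ kp : ℕ × M in atTop ×ˢ 𝓝 q, |B| * ‖F kp.2‖ < ε := by
    have h1 := hF.const_mul |B|
    rw [mul_zero] at h1
    exact tendsto_snd.eventually (h1.eventually (gt_mem_nhds hε))
  filter_upwards [hB, hBF] with kp hkp hlt m a hmem
  obtain ⟨h1, h2⟩ := hkp m a hmem
  have h3 : B * ‖F kp.2‖ ≤ ε :=
    (mul_le_mul_of_nonneg_right (le_abs_self B) (norm_nonneg _)).trans hlt.le
  refine ⟨h1.trans ?_, h2.trans h3⟩
  rw [sq, ← mul_assoc]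
  exact mul_le_mul_of_nonneg_right h3 (norm_nonneg _)

end Convergence

end RiemannianNewton

theorem proposition5p1
    {E : Type*} [NormedAddCommGroup E] [NormedSpace ℝ E] [FiniteDimensional ℝ E]
    {H : Type*} [TopologicalSpace H] (I : ModelWithCorners ℝ E H) [I.Boundaryless]
    -- a connected, complete Riemannian manifold with its Riemannian distance
    {M : Type*} [MetricSpace M] [ChartedSpace H M] [IsManifold I ∞ M]
    [RiemannianBundle (fun x : M => TangentSpace I x)]
    [IsContMDiffRiemannianBundle I ∞ E (fun x : M => TangentSpace I x)]
    [IsRiemannianManifold I M] [ConnectedSpace M] [CompleteSpace M]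
    (nabla : CovariantDerivative I E (fun x : M => TangentSpace I x))
    (hnabla : RiemannianNewton.IsLeviCivita I nabla)
    (R : TangentBundle I M → M) (hR : RiemannianNewton.IsRetraction I R)
    (F : (x : M) → TangentSpace I x) (hF : RiemannianNewton.IsCnVectorField I 2 F)
    (pstar : M) (hzero : F pstar = 0) (hnonsing : Function.Bijective (nabla F pstar))
    -- the perturbation field, bounded near `pstar`
    (e : (x : M) → TangentSpace I x) (he : ∃ C : ℝ, ∀ᶠ x in 𝓝 pstar, ‖e x‖ ≤ C)
    (A : RiemannianNewton.ParameterRule M) (hA : RiemannianNewton.MuVanishesAt A pstar) :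
    (RiemannianNewton.IsSuperlinearScheme I F A pstar →
      ∃ δ > 0, ∀ (p : ℕ → M) (ξ : (k : ℕ) → TangentSpace I (p k)) (μ α : ℕ → ℝ),
        dist (p 0) pstar < δ →
        (∀ n, RiemannianNewton.IsRun I nabla F e R p ξ μ α n →
          RiemannianNewton.Obeys A p μ α n → Function.Bijective (nabla F (p n))) ∧
        ((∀ n, RiemannianNewton.IsRun I nabla F e R p ξ μ α n ∧
          RiemannianNewton.Obeys A p μ α n) →
          RiemannianNewton.ConvergesSuperlinearly p pstar)) ∧
    (RiemannianNewton.IsQuadraticScheme I F A pstar →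
      ∃ δ > 0, ∀ (p : ℕ → M) (ξ : (k : ℕ) → TangentSpace I (p k)) (μ α : ℕ → ℝ),
        dist (p 0) pstar < δ →
        (∀ n, RiemannianNewton.IsRun I nabla F e R p ξ μ α n →
          RiemannianNewton.Obeys A p μ α n → Function.Bijective (nabla F (p n))) ∧
        ((∀ n, RiemannianNewton.IsRun I nabla F e R p ξ μ α n ∧
          RiemannianNewton.Obeys A p μ α n) →
          RiemannianNewton.ConvergesQuadratically p pstar)) := by
  obtain ⟨C, hC, r, hr, m₀, hm₀, hest⟩ :=
    RiemannianNewton.exists_damped_newton_step_estimate hnabla hR hF hzero hnonsing he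
  replace hest : RiemannianNewton.StepEstimate I nabla F e R pstar C r m₀ := hest
  refine ⟨fun hs => ?_, fun hs => ?_⟩
  · obtain ⟨δ, hδ, H⟩ := hest.exists_convergence hC hr hm₀ hA hs
    exact ⟨δ, hδ, fun p ξ μ α hp => ⟨(H p ξ μ α hp).1, fun hrun =>
      hest.convergesSuperlinearly hC hr hm₀ hs
        (fun k => (hrun (k + 1)).1.isStep (hrun (k + 1)).2 k.lt_succ_self)
        ((H p ξ μ α hp).2 hrun)⟩⟩
  · obtain ⟨δ, hδ, H⟩ := hest.exists_convergence hC hr hm₀ hA (hs.isSuperlinearScheme hest hr)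
    exact ⟨δ, hδ, fun p ξ μ α hp => ⟨(H p ξ μ α hp).1, fun hrun =>
      hest.convergesQuadratically hC hr hm₀ hs
        (fun k => (hrun (k + 1)).1.isStep (hrun (k + 1)).2 k.lt_succ_self)
        ((H p ξ μ α hp).2 hrun)⟩⟩
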